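/- Let $C$ be an even positive integer and let $P,Q$ be the positive integers such that $PQ$ is the largest squarefree divisor of $C$ and $C/P$ is a perfect square (so $P$ is the squarefree part of $C$). Suppose that $$x^2+C=y^n$$ for a positive integer $n$ and coprime nonzero integers $x,y$, each divisible by at most one prime, where $(|x|,|y|,n)\neq(7,3,4)$ and $(|x|,|y|,n)\neq(401,11,5)$. Then $n=3$ or $$n \;\Big|\; N = 2\cdot 3^{u}\, h(-P)\,\operatorname{lcm}_{q\mid Q}\Big(q-\Big(\frac{-P}{q}\Big)\Big).$$ Here $u=1$ if $P>3$ and $P\equiv 3 \pmod 8$, and $u=0$ otherwise; $h(-P)$ is the least positive integer $h$ such that $\mathfrak a^h$ is principal for every ideal $\mathfrak a$ of the ring of integers of $\mathbb{Q}(\sqrt{-P})$; $q$ runs through the primes dividing $Q$, and the least common multiple is $1$ if $Q=1$; $\big(\frac{a}{q}\big)$ is the Legendre symbol for an odd prime $q$, and $\big(\frac{a}{2}\big)=0$. -/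

import Mathlib

/-- The imaginary quadratic field `ℚ(√(-P))`, realised inside `ℂ`. -/
noncomputable abbrev imagQuadField (P : ℕ) : IntermediateField ℚ ℂ :=
  IntermediateField.adjoin ℚ {Complex.I * (Real.sqrt (P : ℝ) : ℂ)}

/-- The least positive integer `h` such that `𝔞 ^ h` is principal for every ideal `𝔞` of the
ring of integers of `ℚ(√(-P))`. -/
noncomputable def idealExponent (P : ℕ) : ℕ :=
  sInf {h : ℕ | 0 < h ∧
    ∀ I : Ideal (NumberField.RingOfIntegers (imagQuadField P)), (I ^ h).IsPrincipal}

/-- The Legendre symbol `(a / q)` for an odd prime `q`, with the convention `(a / 2) = 0`.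
The value `0` for non-prime `q` is never used. -/
noncomputable def legendreOrZero (a : ℤ) (q : ℕ) : ℤ :=
  open Classical in
  if h : q.Prime ∧ q ≠ 2 then @legendreSym q ⟨h.1⟩ a else 0

/-- The least common multiple of the numbers `q - (-P / q)` over the primes `q` dividing `Q`;
it is `1` when there are no such primes. -/
noncomputable def symbolLcm (P Q : ℕ) : ℤ :=
  Q.primeFactors.lcm (fun q => (q : ℤ) - legendreOrZero (-(P : ℤ)) q)

/-- The number `N = 2 · 3 ^ u · h(-P) · lcm (q - (-P / q))`, with `u = 1` if
`3 < P ≡ 3 (mod 8)` and `u = 0` otherwise. -/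
noncomputable def exponentBound (P Q : ℕ) : ℤ :=
  2 * 3 ^ (if 3 < P ∧ P % 8 = 3 then 1 else 0) * (idealExponent P : ℤ) * symbolLcm P Q

/-- The integer `z` is nonzero and is divisible by at most one (positive) prime. -/
def AtMostOnePrime (z : ℤ) : Prop :=
  z ≠ 0 ∧ ∀ p q : ℕ, p.Prime → q.Prime → (p : ℤ) ∣ z → (q : ℤ) ∣ z → p = q

/-!
Write `C = P k²`, so that `x² + P k² = y ^ n` with `y` odd. The ideals generated by `x ± k√(-P)` are
coprime, hence `x + k√(-P)` generates an `n`-th power of an ideal, and by the choice of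
`idealExponent P` it is a unit times the power `α ^ m` of an integer `α` of `ℚ(√(-P))`, with
`n / m ∣ h(-P)` (`exists_unit_mul_pow`). The units are harmless. The integer `α` can fail to lie in
`ℤ[√(-P)]` only if `P ≡ 3 (mod 8)`; then a unit repairs this if `P = 3`, and otherwise `3 ∣ m` and the
cube of `α` lies in `ℤ[√(-P)]`. So `x + k√(-P) = ±g ^ m` with `g` in `ℤ[√(-P)]`, where `n / m` divides
`3 ^ u h(-P)` (`exists_pow_eq_in_zsqrtd`).

If `m` divides `2 lcm (q - (-P/q))`, this proves the claim. Otherwise some prime power `r ^ (e + 1)`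
divides `m` but not `2 lcm (q - (-P/q))`. For a prime `q ∣ k` with `q ∤ P`, the rank of apparition of
`q` in the sequence `im (g ^ j)` divides `q - (-P/q)` by Frobenius. Therefore, with `m = r m'`, the
step from `g ^ m' = c + d√(-P) = c + √(-D)` to its `r`-th power brings no prime other than `r` into
the imaginary part: `(c + √(-D)) ^ r = V + U√(-D)` with `U` a power of `r` up to sign
(`no_primitive_prime`). Moreover `V = ±x` has at most one prime divisor, and `c² + D` is a power
of `|y|`.

* For `r ≥ 5`, the number `U` is `±1` or `±r`, and the cofactor of `c` in `V` is at most `r` unless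
  `c = ±1`; comparing with the norm leaves `c = ±1` (`natAbs_eq_one_of_atMostOnePrime`). Then `U = ±r`
  only for `D = 10`, `r = 5`, which is `401² + 250 = 11 ^ 5` (`eq_ten_of_im_one_pow`). `U = 1` is
  impossible by comparing the `l`-adic valuations of the terms of the binomial sum for a prime
  `l ∣ D` (`im_one_pow_ne_one`), with one congruence modulo `5` for `D = 6`.
  `U = -1` is impossible because then `1 + D`, a prime power, is a power of `5`, and the sequence can be
  followed modulo `56` (`im_one_pow_ne_neg_one`).
* For `r = 3`, one finds `c = ±1`, and the norm `c² + D` is `3` or `3 ^ s + 4`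
  (`norm_eq_of_exponent_three`). Neither is a proper power (`three_pow_add_four_ne_pow`, which uses the
  case `r ≥ 5` in `ℤ[i]` and unique factorisation in `ℚ(√(-3))`); since it equals `|y| ^ (n / 3)`, this
  gives `n = 3`.
* For `r = 2`, the factor `2` in `2 lcm (q - (-P/q))` allows the argument for two successive squarings.
  They force `g ^ (m / 4) = ±1 ± √(-2)`, hence `7² + 32 = 3 ^ 4`
  (`natAbs_eq_seven_of_exponent_two`).
-/

/-! ### Powers in `ℤ[√d]` and the rank of apparition of a prime -/

theorem Zsqrtd.sqrtd_pow_re (d : ℤ) (i : ℕ) :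
    ((Zsqrtd.sqrtd : ℤ√d) ^ i).re = if Even i then d ^ (i / 2) else 0 := by
  have h2 : (Zsqrtd.sqrtd : ℤ√d) ^ 2 = (d : ℤ√d) := by rw [sq, Zsqrtd.dmuld]
  rcases Nat.even_or_odd' i with ⟨k, rfl | rfl⟩
  · rw [pow_mul, h2, ← Int.cast_pow, Zsqrtd.re_intCast]; simp
  · rw [pow_succ, pow_mul, h2, ← Int.cast_pow, Zsqrtd.re_smul]; simp

theorem Zsqrtd.sqrtd_pow_im (d : ℤ) (i : ℕ) :
    ((Zsqrtd.sqrtd : ℤ√d) ^ i).im = if Odd i then d ^ (i / 2) else 0 := by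
  have h2 : (Zsqrtd.sqrtd : ℤ√d) ^ 2 = (d : ℤ√d) := by rw [sq, Zsqrtd.dmuld]
  rcases Nat.even_or_odd' i with ⟨k, rfl | rfl⟩
  · rw [pow_mul, h2, ← Int.cast_pow, Zsqrtd.im_intCast, if_neg]
    exact Nat.not_odd_iff_even.2 (even_two_mul k)
  · rw [pow_succ, pow_mul, h2, ← Int.cast_pow, Zsqrtd.im_smul]
    simp [show (2 * k + 1) / 2 = k by omega]

theorem Zsqrtd.re_sum {d : ℤ} {ι : Type*} (s : Finset ι) (f : ι → ℤ√d) :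
    (∑ i ∈ s, f i).re = ∑ i ∈ s, (f i).re := by
  classical
  induction s using Finset.induction_on with
  | empty => simp
  | insert a s ha ih => simp [Finset.sum_insert ha, ih]

theorem Zsqrtd.im_sum {d : ℤ} {ι : Type*} (s : Finset ι) (f : ι → ℤ√d) :
    (∑ i ∈ s, f i).im = ∑ i ∈ s, (f i).im := by
  classical
  induction s using Finset.induction_on with
  | empty => simp
  | insert a s ha ih => simp [Finset.sum_insert ha, ih]

theorem Zsqrtd.mk_one_pow_eq_sum (d c : ℤ) (n : ℕ) :
    (⟨c, 1⟩ : ℤ√d) ^ n =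
      ∑ i ∈ Finset.range (n + 1), ((c ^ (n - i) * n.choose i : ℤ) : ℤ√d) * Zsqrtd.sqrtd ^ i := by
  have h : (⟨c, 1⟩ : ℤ√d) = Zsqrtd.sqrtd + (c : ℤ√d) := by ext <;> simp
  rw [h, add_pow]
  refine Finset.sum_congr rfl fun i _ => ?_
  push_cast
  ring

theorem Zsqrtd.mk_one_pow_re (d c : ℤ) (n : ℕ) :
    ((⟨c, 1⟩ : ℤ√d) ^ n).re =
      ∑ i ∈ Finset.range (n + 1), c ^ (n - i) * n.choose i * (if Even i then d ^ (i / 2) else 0) := by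
  rw [Zsqrtd.mk_one_pow_eq_sum, Zsqrtd.re_sum]
  refine Finset.sum_congr rfl fun i _ => ?_
  rw [Zsqrtd.re_smul, Zsqrtd.sqrtd_pow_re]

theorem Zsqrtd.mk_one_pow_im (d c : ℤ) (n : ℕ) :
    ((⟨c, 1⟩ : ℤ√d) ^ n).im =
      ∑ i ∈ Finset.range (n + 1), c ^ (n - i) * n.choose i * (if Odd i then d ^ (i / 2) else 0) := by
  rw [Zsqrtd.mk_one_pow_eq_sum, Zsqrtd.im_sum]
  refine Finset.sum_congr rfl fun i _ => ?_
  rw [Zsqrtd.im_smul, Zsqrtd.sqrtd_pow_im]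

/-- Rescaling the square root: `(c + b√d) ^ n` can be computed as a power of `c + √(d b²)`. -/
theorem Zsqrtd.mk_pow_eq_rescale (d c b : ℤ) (n : ℕ) :
    (⟨c, b⟩ : ℤ√d) ^ n =
      ⟨((⟨c, 1⟩ : ℤ√(d * b ^ 2)) ^ n).re, b * ((⟨c, 1⟩ : ℤ√(d * b ^ 2)) ^ n).im⟩ := by
  induction n with
  | zero => ext <;> simp
  | succ n ih => rw [pow_succ, ih, pow_succ (⟨c, 1⟩ : ℤ√(d * b ^ 2)) n]; ext <;> simp <;> ring

theorem Zsqrtd.norm_pow {d : ℤ} (z : ℤ√d) (n : ℕ) : (z ^ n).norm = z.norm ^ n :=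
  map_pow Zsqrtd.normMonoidHom z n

/-- If a prime `q` does not divide the norm of `g`, the exponents `j` for which `q` divides the
imaginary part of `g ^ j` are closed under subtraction. -/
theorem Zsqrtd.dvd_im_pow_of_add {d : ℤ} (g : ℤ√d) {q : ℤ} (hq : Prime q) (hn : ¬ q ∣ g.norm)
    {i j : ℕ} (hi : q ∣ (g ^ i).im) (hij : q ∣ (g ^ (i + j)).im) : q ∣ (g ^ j).im := by
  have hni : ¬ q ∣ (g ^ i).norm := by
    rw [Zsqrtd.norm_pow]; exact fun h => hn (hq.dvd_of_dvd_pow h)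
  rw [pow_add, Zsqrtd.im_mul] at hij
  have h1 : q ∣ (g ^ i).re * (g ^ j).im := (dvd_add_left (hi.mul_right _)).1 hij
  refine (hq.dvd_or_dvd h1).resolve_left fun h => hni ?_
  rw [Zsqrtd.norm_def]
  exact dvd_sub (h.mul_right _) (hi.mul_left _)

/-- The exponents `j` with `q ∣ im (g ^ j)` are closed under greatest common divisors; so they are
the multiples of the least one, the rank of apparition of `q`. -/
theorem Zsqrtd.dvd_im_pow_gcd {d : ℤ} (g : ℤ√d) {q : ℤ} (hq : Prime q) (hn : ¬ q ∣ g.norm)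
    (i j : ℕ) (hi : q ∣ (g ^ i).im) (hj : q ∣ (g ^ j).im) : q ∣ (g ^ (i.gcd j)).im := by
  induction h : i + j using Nat.strong_induction_on generalizing i j with
  | _ s ih =>
    rcases Nat.eq_zero_or_pos i with rfl | hi0
    · simpa using hj
    rcases Nat.eq_zero_or_pos j with rfl | hj0
    · simpa using hi
    rcases le_total i j with hij | hij
    · obtain ⟨k, rfl⟩ := Nat.exists_eq_add_of_le hij
      have := ih (i + k) (by omega) i k hi (Zsqrtd.dvd_im_pow_of_add g hq hn hi hj) rfl
      simpa using this
    · obtain ⟨k, rfl⟩ := Nat.exists_eq_add_of_le hij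
      have := ih (k + j) (by omega) k j (Zsqrtd.dvd_im_pow_of_add g hq hn hj hi) hj rfl
      simpa using this

theorem Zsqrtd.dvd_im_pow_mul {d : ℤ} (g : ℤ√d) {q : ℤ} (i j : ℕ) (hi : q ∣ (g ^ i).im) :
    q ∣ (g ^ (i * j)).im := by
  induction j with
  | zero => simp
  | succ j ih =>
    rw [mul_add, mul_one, pow_add, Zsqrtd.im_mul]
    exact dvd_add (hi.mul_left _) (ih.mul_right _)

/-- The Frobenius congruence: for an odd prime `q` the prime `q` divides the imaginary part of
`g ^ (q - (d/q))`. -/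
theorem Zsqrtd.dvd_im_pow_legendre {d : ℤ} (g : ℤ√d) {q : ℕ} [Fact q.Prime] (hq2 : q ≠ 2)
    (hn : ¬ (q : ℤ) ∣ g.norm) (hd : ¬ (q : ℤ) ∣ d) {M : ℕ} (hM : (M : ℤ) = q - legendreSym q d) :
    (q : ℤ) ∣ (g ^ M).im := by
  have hqp : q.Prime := Fact.out
  have hqz : Prime (q : ℤ) := Nat.prime_iff_prime_int.1 hqp
  have hodd : Odd q := hqp.odd_of_ne_two hq2
  have hfrob : (q : ℤ) ∣ (g ^ q).re - g.re ∧ (q : ℤ) ∣ (g ^ q).im - legendreSym q d * g.im := by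
    have hdec : g = (g.re : ℤ√d) + Zsqrtd.sqrtd * (g.im : ℤ√d) := by
      ext <;> simp
    obtain ⟨r, hr⟩ := exists_add_pow_prime_eq hqp (g.re : ℤ√d) (Zsqrtd.sqrtd * (g.im : ℤ√d))
    rw [← hdec, mul_pow, ← Int.cast_pow, ← Int.cast_pow] at hr
    have hre := congrArg Zsqrtd.re hr
    have him := congrArg Zsqrtd.im hr
    have hne : ¬ Even q := Nat.not_even_iff_odd.2 hodd
    have fl (a : ℤ) : (q : ℤ) ∣ a ^ q - a := by
      rw [← ZMod.intCast_zmod_eq_zero_iff_dvd]; simp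
    have hleg : (q : ℤ) ∣ d ^ (q / 2) - legendreSym q d := by
      rw [← ZMod.intCast_zmod_eq_zero_iff_dvd]; simp [legendreSym.eq_pow]
    have hq0 : ((q : ℤ√d)) = ((q : ℤ) : ℤ√d) := by simp
    rw [hq0, mul_assoc, mul_assoc] at hre him
    generalize (g.re : ℤ√d) * (Zsqrtd.sqrtd * (g.im : ℤ√d) * r) = w at hre him
    simp only [Zsqrtd.re_add, Zsqrtd.im_add, Zsqrtd.re_intCast, Zsqrtd.im_intCast,
      Zsqrtd.re_mul, Zsqrtd.im_mul, Zsqrtd.sqrtd_pow_re, Zsqrtd.sqrtd_pow_im, hne, hodd,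
      if_true, if_false] at hre him
    obtain ⟨s, hs⟩ := fl g.re
    obtain ⟨t, ht⟩ := fl g.im
    obtain ⟨l, hl⟩ := hleg
    constructor
    · exact ⟨s + w.re, by rw [hre]; linear_combination hs⟩
    · exact ⟨d ^ (q / 2) * t + l * g.im + w.im, by
        rw [him]; linear_combination d ^ (q / 2) * ht + g.im * hl⟩
  obtain ⟨⟨s, hs⟩, ⟨t, ht⟩⟩ := hfrob
  have hd' : ((d : ℤ) : ZMod q) ≠ 0 := by
    rwa [Ne, ZMod.intCast_zmod_eq_zero_iff_dvd]
  rcases legendreSym.eq_one_or_neg_one q hd' with h1 | h1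
  · rw [h1] at ht hM
    have hM' : q = 1 + M := by omega
    have h2 : (g * g ^ M) = g ^ q := by conv_rhs => rw [hM', pow_add, pow_one]
    have h3 : (q : ℤ) ∣ g.norm * (g ^ M).im := by
      have e1 := congrArg Zsqrtd.re h2
      have e2 := congrArg Zsqrtd.im h2
      simp only [Zsqrtd.re_mul, Zsqrtd.im_mul] at e1 e2
      refine ⟨g.re * t - g.im * s, ?_⟩
      rw [Zsqrtd.norm_def]
      linear_combination g.re * e2 - g.im * e1 + g.re * ht - g.im * hs
    exact (hqz.dvd_or_dvd h3).resolve_left hn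
  · rw [h1] at ht hM
    have hM' : M = q + 1 := by omega
    rw [hM', pow_succ, Zsqrtd.im_mul]
    exact ⟨s * g.im + t * g.re, by linear_combination g.im * hs + g.re * ht⟩

/-! ### Integers with at most one prime divisor -/

theorem AtMostOnePrime.exists_natAbs_eq {z : ℤ} (hz : AtMostOnePrime z) :
    ∃ p j : ℕ, p.Prime ∧ z.natAbs = p ^ j := by
  by_cases h1 : z.natAbs = 1
  · exact ⟨2, 0, Nat.prime_two, by simpa using h1⟩
  · refine ⟨_, _, Nat.minFac_prime h1, Nat.eq_prime_pow_of_unique_prime_dvd (by simpa using hz.1) ?_⟩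
    intro d hd hdz
    exact hz.2 _ _ hd (Nat.minFac_prime h1) (Int.natCast_dvd.2 hdz)
      (Int.natCast_dvd.2 (Nat.minFac_dvd _))

theorem AtMostOnePrime.of_dvd {z w : ℤ} (hz : AtMostOnePrime z) (hw : w ∣ z) : AtMostOnePrime w :=
  ⟨fun h => hz.1 (by simpa [h] using hw),
    fun p q hp hq h1 h2 => hz.2 p q hp hq (h1.trans hw) (h2.trans hw)⟩

theorem atMostOnePrime_prime_pow {p : ℕ} (hp : p.Prime) (j : ℕ) : AtMostOnePrime ((p : ℤ) ^ j) := by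
  refine ⟨by have := hp.ne_zero; positivity, fun a b ha hb h1 h2 => ?_⟩
  rw [(Nat.prime_dvd_prime_iff_eq ha hp).1 (Int.natCast_dvd_natCast.1
      ((Nat.prime_iff_prime_int.1 ha).dvd_of_dvd_pow h1)),
    (Nat.prime_dvd_prime_iff_eq hb hp).1 (Int.natCast_dvd_natCast.1
      ((Nat.prime_iff_prime_int.1 hb).dvd_of_dvd_pow h2))]

theorem AtMostOnePrime.pow {z : ℤ} (hz : AtMostOnePrime z) (j : ℕ) : AtMostOnePrime (z ^ j) :=
  ⟨pow_ne_zero _ hz.1, fun p q hp hq h1 h2 => hz.2 p q hp hq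
    ((Nat.prime_iff_prime_int.1 hp).dvd_of_dvd_pow h1)
    ((Nat.prime_iff_prime_int.1 hq).dvd_of_dvd_pow h2)⟩

/-! ### The imaginary part of `(1 + √(-D)) ^ r` is not `1` -/

/-- Even and odd powers of `√(-D)` combine into one sum, because
`im ((1 + √(-D)) ^ (e + 1))` is the sum of both coordinates of `(1 + √(-D)) ^ e`. -/
theorem im_one_pow_eq_sum (D e : ℕ) :
    ((⟨1, 1⟩ : ℤ√(-(D : ℤ))) ^ (e + 1)).im =
      ∑ i ∈ Finset.range (e + 1), (e.choose i : ℤ) * (-(D : ℤ)) ^ (i / 2) := by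
  rw [pow_succ, Zsqrtd.im_mul, Zsqrtd.mk_one_pow_re, Zsqrtd.mk_one_pow_im]
  simp only [mul_one, ← Finset.sum_add_distrib]
  refine Finset.sum_congr rfl fun i _ => ?_
  rcases Nat.even_or_odd i with h | h
  · simp [h, Nat.not_odd_iff_even.2 h]
  · simp [h, Nat.not_even_iff_odd.2 h]

/-- A uniform `l`-adic criterion: in `1 = ∑ C(e, i) (-D) ^ ⌊i/2⌋` the term `i = 1`, which is `e`,
has strictly smaller `l`-adic valuation than all terms with `i ≥ 2`. -/
theorem im_one_pow_ne_one_of_dvd {D e l : ℕ} (hl : l.Prime) (he : 0 < e)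
    (hD : ∀ i, 2 ≤ i → l ^ (padicValNat l i + 1) ∣ D ^ (i / 2)) :
    ((⟨1, 1⟩ : ℤ√(-(D : ℤ))) ^ (e + 1)).im ≠ 1 := by
  have := Fact.mk hl
  set k := padicValNat l e with hk
  have key : ∀ i, 2 ≤ i → ((l ^ (k + 1) : ℕ) : ℤ) ∣ (e.choose i : ℤ) * (-(D : ℤ)) ^ (i / 2) := by
    intro i hi
    have h1 : l ^ (k + 1) ∣ e.choose i * D ^ (i / 2) := by
      -- from `i * C(e, i) = e * C(e - 1, i - 1)`
      have h2 : l ^ k ∣ l ^ padicValNat l i * e.choose i := by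
        have hle : l ^ k ∣ e := pow_padicValNat_dvd
        obtain ⟨i', hi'⟩ := pow_padicValNat_dvd (p := l) (n := i)
        have hco : Nat.Coprime (l ^ k) i' := by
          refine Nat.Coprime.pow_left _ ((Nat.Prime.coprime_iff_not_dvd hl).2 fun h => ?_)
          refine pow_succ_padicValNat_not_dvd (p := l) (n := i) (by omega) ?_
          rw [pow_succ]
          conv_rhs => rw [hi']
          exact mul_dvd_mul_left _ h
        have h3 : l ^ k ∣ i' * (l ^ padicValNat l i * e.choose i) := by
          have : i * e.choose i = e * (e - 1).choose (i - 1) := by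
            obtain ⟨e, rfl⟩ := Nat.exists_eq_succ_of_ne_zero he.ne'
            obtain ⟨i, rfl⟩ := Nat.exists_eq_succ_of_ne_zero (show i ≠ 0 by omega)
            have := Nat.add_one_mul_choose_eq e i
            simp only [Nat.succ_eq_add_one, Nat.add_sub_cancel]
            linarith
          have h4 : i' * (l ^ padicValNat l i * e.choose i) = i * e.choose i := by
            rw [← mul_assoc, mul_comm i', ← hi']
          rw [h4, this]
          exact hle.mul_right _
        exact hco.dvd_of_dvd_mul_left h3
      have h5 : l ^ (k + 1) ∣ l ^ (padicValNat l i + 1) * e.choose i := by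
        rw [pow_succ, pow_succ, mul_right_comm]
        exact mul_dvd_mul_right h2 _
      rw [mul_comm]
      exact h5.trans (mul_dvd_mul_right (hD i hi) _)
    have h6 : ((l ^ (k + 1) : ℕ) : ℤ) ∣ (e.choose i : ℤ) * (D : ℤ) ^ (i / 2) := by
      exact_mod_cast h1
    rw [neg_pow, mul_left_comm]
    exact h6.mul_left _
  intro h
  rw [im_one_pow_eq_sum] at h
  obtain ⟨e, rfl⟩ := Nat.exists_eq_succ_of_ne_zero he.ne'
  rw [Finset.sum_range_succ', Finset.sum_range_succ'] at h
  simp only [Nat.choose_zero_right, Nat.choose_one_right, Nat.zero_div, pow_zero, mul_one,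
    zero_add, Nat.reduceDiv, Nat.cast_one] at h
  have hdvd : ((l ^ (k + 1) : ℕ) : ℤ) ∣ ((e.succ : ℕ) : ℤ) := by
    have := Finset.dvd_sum (s := Finset.range e) fun i _ => key (i + 1 + 1) (by omega)
    rw [← (dvd_add_right this)]
    exact ⟨0, by linarith⟩
  exact pow_succ_padicValNat_not_dvd (p := l) (by omega) (Int.natCast_dvd_natCast.1 hdvd)

theorem im_one_pow_ne_one_of_four_dvd {D e : ℕ} (he : 0 < e) (hD : 4 ∣ D) :
    ((⟨1, 1⟩ : ℤ√(-(D : ℤ))) ^ (e + 1)).im ≠ 1 := by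
  refine im_one_pow_ne_one_of_dvd Nat.prime_two he fun i hi => ?_
  refine dvd_trans ?_ (pow_dvd_pow_of_dvd hD _)
  rw [show 4 = 2 ^ 2 by norm_num, ← pow_mul]
  refine pow_dvd_pow _ ?_
  have h1 : 2 ^ padicValNat 2 i ∣ i := pow_padicValNat_dvd
  rcases Nat.eq_zero_or_pos (padicValNat 2 i) with h0 | h0
  · omega
  · have h2 : 2 ∣ i := (dvd_pow_self 2 h0.ne').trans h1
    have h3 := Nat.le_of_dvd (by omega) h1
    have h4 : padicValNat 2 i < 2 ^ padicValNat 2 i := Nat.lt_two_pow_self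
    omega

theorem im_one_pow_ne_one_of_nine_dvd {D e : ℕ} (he : 0 < e) (hD : 9 ∣ D) :
    ((⟨1, 1⟩ : ℤ√(-(D : ℤ))) ^ (e + 1)).im ≠ 1 := by
  refine im_one_pow_ne_one_of_dvd Nat.prime_three he fun i hi => ?_
  refine dvd_trans ?_ (pow_dvd_pow_of_dvd hD _)
  rw [show 9 = 3 ^ 2 by norm_num, ← pow_mul]
  refine pow_dvd_pow _ ?_
  have h1 : 3 ^ padicValNat 3 i ∣ i := pow_padicValNat_dvd
  have h3 := Nat.le_of_dvd (by omega) h1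
  have h4 : ∀ v : ℕ, 2 * v + 1 ≤ 3 ^ v := fun v => by
    induction v with
    | zero => simp
    | succ v ih => rw [pow_succ]; omega
  have h4 := h4 (padicValNat 3 i)
  omega

theorem im_one_pow_ne_one_of_prime_dvd {D e l : ℕ} (hl : l.Prime) (hl5 : 5 ≤ l) (he : 0 < e)
    (hD : l ∣ D) : ((⟨1, 1⟩ : ℤ√(-(D : ℤ))) ^ (e + 1)).im ≠ 1 := by
  refine im_one_pow_ne_one_of_dvd hl he fun i hi => ?_
  refine dvd_trans ?_ (pow_dvd_pow_of_dvd hD _)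
  refine pow_dvd_pow _ ?_
  have h1 : l ^ padicValNat l i ∣ i := pow_padicValNat_dvd
  have h3 := Nat.le_of_dvd (by omega) h1
  have h4 : ∀ v : ℕ, 4 * v + 1 ≤ 5 ^ v := fun v => by
    induction v with
    | zero => simp
    | succ v ih => rw [pow_succ]; omega
  have h4 := h4 (padicValNat l i)
  have h5 : 5 ^ padicValNat l i ≤ l ^ padicValNat l i := Nat.pow_le_pow_left (by omega) _
  omega

/-- For `D ≡ 2 (mod 4)` the powers of `1 + √(-D)` with exponent `2 ^ k * t`, `t` odd, are congruent
to `1 + 2 ^ k √(-D)` modulo `2 ^ (k + 1)`. -/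
theorem dvd_one_pow_two_pow_mul_sub {D : ℕ} (hD : D % 4 = 2) (k : ℕ) (hk : 2 ≤ k) {t : ℕ} (ht : Odd t) :
    (2 : ℤ) ^ (k + 1) ∣ ((⟨1, 1⟩ : ℤ√(-(D : ℤ))) ^ (2 ^ k * t)).re - 1 ∧
    (2 : ℤ) ^ (k + 1) ∣ ((⟨1, 1⟩ : ℤ√(-(D : ℤ))) ^ (2 ^ k * t)).im - 2 ^ k := by
  have base : (2 : ℤ) ^ (k + 1) ∣ ((⟨1, 1⟩ : ℤ√(-(D : ℤ))) ^ (2 ^ k)).re - 1 ∧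
      (2 : ℤ) ^ (k + 1) ∣ ((⟨1, 1⟩ : ℤ√(-(D : ℤ))) ^ (2 ^ k)).im - 2 ^ k := by
    induction k, hk using Nat.le_induction with
    | base =>
      obtain ⟨f, hf⟩ : ∃ f : ℕ, D = 4 * f + 2 := ⟨D / 4, by omega⟩
      have h4 : (⟨1, 1⟩ : ℤ√(-(D : ℤ))) ^ (2 ^ 2) = ⟨1 - 6 * D + D ^ 2, 4 - 4 * D⟩ := by
        rw [show (2 : ℕ) ^ 2 = 2 + 2 by norm_num, pow_add, sq]
        ext <;> simp <;> ring
      rw [h4, hf]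
      push_cast
      exact ⟨⟨2 * f ^ 2 - f - 1, by ring⟩, ⟨-(2 * f + 1), by ring⟩⟩
    | succ k hk ih =>
      obtain ⟨⟨a, ha⟩, ⟨b, hb⟩⟩ := ih
      obtain ⟨j, rfl⟩ : ∃ j, k = j + 2 := ⟨k - 2, by omega⟩
      rw [pow_succ 2 (j + 2), pow_mul _ _ 2, sq, Zsqrtd.re_mul, Zsqrtd.im_mul]
      have ha' := eq_add_of_sub_eq ha
      have hb' := eq_add_of_sub_eq hb
      rw [ha', hb']
      exact ⟨⟨a + 2 ^ (j + 2) * a ^ 2 - D * 2 ^ j * (1 + 2 * b) ^ 2, by ring⟩,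
        ⟨b + 2 ^ (j + 2) * a + 2 ^ (j + 3) * a * b, by ring⟩⟩
  obtain ⟨s, rfl⟩ := ht
  induction s with
  | zero => simpa using base
  | succ s ih =>
    obtain ⟨⟨a, ha⟩, ⟨b, hb⟩⟩ := base
    obtain ⟨⟨a', ha'⟩, ⟨b', hb'⟩⟩ := ih
    obtain ⟨j, rfl⟩ : ∃ j, k = j + 2 := ⟨k - 2, by omega⟩
    have h1 : (⟨1, 1⟩ : ℤ√(-(D : ℤ))) ^ (2 ^ (j + 2) * (2 * (s + 1) + 1)) =
      (⟨1, 1⟩ : ℤ√(-(D : ℤ))) ^ (2 ^ (j + 2) * (2 * s + 1)) *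
      ((⟨1, 1⟩ : ℤ√(-(D : ℤ))) ^ (2 ^ (j + 2)) * (⟨1, 1⟩ : ℤ√(-(D : ℤ))) ^ (2 ^ (j + 2))) := by
      rw [← pow_add, ← pow_add]; congr 1; ring
    rw [h1]
    generalize (⟨1, 1⟩ : ℤ√(-(D : ℤ))) ^ (2 ^ (j + 2) * (2 * s + 1)) = z at *
    generalize (⟨1, 1⟩ : ℤ√(-(D : ℤ))) ^ (2 ^ (j + 2)) = w at *
    have h2 : (2 : ℤ) ^ (j + 2 + 1) ∣ (w * w).re - 1 := by
      rw [Zsqrtd.re_mul, eq_add_of_sub_eq ha, eq_add_of_sub_eq hb]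
      exact ⟨2 * a + 2 ^ (j + 3) * a ^ 2 - D * 2 ^ (j + 1) * (1 + 2 * b) ^ 2, by ring⟩
    have h3 : (2 : ℤ) ^ (j + 2 + 1) ∣ (w * w).im := by
      rw [Zsqrtd.im_mul, eq_add_of_sub_eq ha, eq_add_of_sub_eq hb]
      exact ⟨(1 + 2 ^ (j + 3) * a) * (1 + 2 * b), by ring⟩
    generalize w * w = v at h2 h3 ⊢
    obtain ⟨m, hm⟩ := h2
    obtain ⟨n, hn⟩ := h3
    rw [Zsqrtd.re_mul, Zsqrtd.im_mul, eq_add_of_sub_eq ha', eq_add_of_sub_eq hb',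
      eq_add_of_sub_eq hm, hn]
    exact ⟨⟨a' + m + 2 ^ (j + 3) * a' * m - D * (2 ^ (j + 3) * b' + 2 ^ (j + 2)) * n, by ring⟩,
      ⟨b' + (1 + 2 ^ (j + 3) * a') * n + (2 ^ (j + 3) * b' + 2 ^ (j + 2)) * m, by ring⟩⟩

theorem exists_eq_two_pow_mul_odd_of_four_dvd {e : ℕ} (he : 0 < e) (h4 : 4 ∣ e) :
    ∃ k t, 2 ≤ k ∧ Odd t ∧ e = 2 ^ k * t := by
  obtain ⟨f, rfl⟩ := h4
  obtain ⟨k, t, ht, hf⟩ := Nat.exists_eq_two_pow_mul_odd (n := f) (by omega)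
  exact ⟨k + 2, t, by omega, ht, by rw [hf]; ring⟩

/-- If `2 ^ k` exactly divides `e`, the imaginary part is `1 + 2 ^ k` modulo `2 ^ (k + 1)`. -/
theorem im_one_pow_add_one_ne_one {D e : ℕ} (hD : D % 4 = 2) (he : 0 < e) (h4 : 4 ∣ e) :
    ((⟨1, 1⟩ : ℤ√(-(D : ℤ))) ^ (e + 1)).im ≠ 1 := by
  obtain ⟨k, t, hk, ht, rfl⟩ := exists_eq_two_pow_mul_odd_of_four_dvd he h4
  obtain ⟨⟨a, ha⟩, ⟨b, hb⟩⟩ := dvd_one_pow_two_pow_mul_sub hD k hk ht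
  intro h
  rw [pow_succ, Zsqrtd.im_mul, eq_add_of_sub_eq ha, eq_add_of_sub_eq hb] at h
  have h0 : (2 : ℤ) ^ k ≠ 0 := by positivity
  have : (2 : ℤ) ^ k * (2 * (a + b) + 1) = 0 := by linear_combination h
  rcases mul_eq_zero.1 this with h | h <;> omega

/-- As `(1 + √(-2)) ^ 3 = -5 + √(-2)` has imaginary part `1`, the exponent `3` is a solution for
`D = 2`; the same 2-adic comparison shows that no larger exponent congruent to `3` modulo `4` is. -/
theorem im_one_pow_add_three_ne_one {e : ℕ} (he : 0 < e) (h4 : 4 ∣ e) :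
    ((⟨1, 1⟩ : ℤ√(-((2 : ℕ) : ℤ))) ^ (e + 3)).im ≠ 1 := by
  obtain ⟨k, t, hk, ht, rfl⟩ := exists_eq_two_pow_mul_odd_of_four_dvd he h4
  obtain ⟨⟨a, ha⟩, ⟨b, hb⟩⟩ := dvd_one_pow_two_pow_mul_sub (D := 2) rfl k hk ht
  intro h
  have h3 : (⟨1, 1⟩ : ℤ√(-((2 : ℕ) : ℤ))) ^ 3 = ⟨-5, 1⟩ := by
    rw [pow_succ, sq]; ext <;> simp
  rw [pow_add, h3, Zsqrtd.im_mul, eq_add_of_sub_eq ha, eq_add_of_sub_eq hb] at h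
  have h0 : (2 : ℤ) ^ k ≠ 0 := by positivity
  have : (2 : ℤ) ^ k * (2 * (a - 5 * b) - 5) = 0 := by linear_combination h
  rcases mul_eq_zero.1 this with h | h <;> omega

/-- For `D = 6` the imaginary parts at exponents congruent to `3` modulo `4` are `-3` modulo `5`. -/
theorem im_one_pow_six_ne_one {f : ℕ} :
    ((⟨1, 1⟩ : ℤ√(-((6 : ℕ) : ℤ))) ^ (4 * f + 3)).im ≠ 1 := by
  -- the fourth power is `1` modulo `5`, so only the cube matters
  have h4 : (⟨1, 1⟩ : ℤ√(-((6 : ℕ) : ℤ))) ^ 4 = ⟨1, -20⟩ := by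
    rw [show 4 = 2 + 2 by norm_num, pow_add, sq]; ext <;> simp
  have h3 : (⟨1, 1⟩ : ℤ√(-((6 : ℕ) : ℤ))) ^ 3 = ⟨-17, -3⟩ := by
    rw [pow_succ, sq]; ext <;> simp
  have h : ∀ f, (5 : ℤ) ∣ ((⟨1, -20⟩ : ℤ√(-((6 : ℕ) : ℤ))) ^ f).re - 1 ∧
      (5 : ℤ) ∣ ((⟨1, -20⟩ : ℤ√(-((6 : ℕ) : ℤ))) ^ f).im := by
    intro f
    induction f with
    | zero => simp
    | succ f ih =>
      rw [pow_succ, Zsqrtd.re_mul, Zsqrtd.im_mul]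
      generalize (⟨1, -20⟩ : ℤ√(-((6 : ℕ) : ℤ))) ^ f = z at ih ⊢
      dsimp only
      omega
  obtain ⟨h1, h2⟩ := h f
  rw [pow_add, pow_mul, h4, h3, Zsqrtd.im_mul]
  dsimp only
  omega

/-- If `D` has a divisor `4`, `9` or a prime `l ≥ 5`, an `l`-adic comparison applies. Otherwise
`D = 2` or `D = 6`, and exponents `1` and `3` modulo `4` are separated 2-adically or modulo `5`. -/
theorem im_one_pow_ne_one {D r : ℕ} (hD : Even D) (hD0 : 0 < D) (hr : Odd r) (hr5 : 5 ≤ r) :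
    ((⟨1, 1⟩ : ℤ√(-(D : ℤ))) ^ r).im ≠ 1 := by
  obtain ⟨e, rfl⟩ : ∃ e, r = e + 1 := ⟨r - 1, by omega⟩
  have he : 0 < e := by omega
  by_cases h4 : 4 ∣ D
  · exact im_one_pow_ne_one_of_four_dvd he h4
  by_cases h9 : 9 ∣ D
  · exact im_one_pow_ne_one_of_nine_dvd he h9
  by_cases hl : ∃ l : ℕ, l.Prime ∧ 5 ≤ l ∧ l ∣ D
  · obtain ⟨l, hl, hl5, hlD⟩ := hl
    exact im_one_pow_ne_one_of_prime_dvd hl hl5 he hlD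
  have hD2 : D % 4 = 2 := by obtain ⟨a, rfl⟩ := hD; omega
  by_cases he4 : 4 ∣ e
  · exact im_one_pow_add_one_ne_one hD2 he he4
  have aux : ∀ d, d ∣ D → ¬ 2 ∣ d → ¬ 3 ∣ d → d = 1 := by
    intro d hd h2 h3
    by_contra h1
    refine hl ⟨d.minFac, Nat.minFac_prime h1, ?_, (Nat.minFac_dvd d).trans hd⟩
    have hp := Nat.minFac_prime h1
    have hm := Nat.minFac_dvd d
    by_contra hlt
    have h2' := hp.two_le
    have : d.minFac = 2 ∨ d.minFac = 3 ∨ d.minFac = 4 := by omega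
    rcases this with h | h | h
    · exact h2 (h ▸ hm)
    · exact h3 (h ▸ hm)
    · rw [h] at hp; norm_num at hp
  have hD26 : D = 2 ∨ D = 6 := by
    by_cases h3 : 3 ∣ D
    · have := aux (D / 6) (Nat.div_dvd_of_dvd (by omega)) (by omega) (by omega)
      omega
    · have := aux (D / 2) (Nat.div_dvd_of_dvd (by omega)) (by omega) (by omega)
      omega
  have hr3 : ∃ f, e + 1 = 4 * f + 3 ∧ 0 < f := by
    obtain ⟨a, ha⟩ := hr
    exact ⟨(e - 2) / 4, by omega, by omega⟩
  obtain ⟨f, hf, hf0⟩ := hr3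
  rw [hf]
  rcases hD26 with rfl | rfl
  · exact im_one_pow_add_three_ne_one (by omega) (by omega)
  · exact im_one_pow_six_ne_one

/-! ### The imaginary part of `(1 + √(-D)) ^ r` is not `-1` -/

theorem mk_one_pow_norm (D : ℕ) (c : ℤ) (n : ℕ) :
    ((⟨c, 1⟩ : ℤ√(-(D : ℤ))) ^ n).re ^ 2 + D * ((⟨c, 1⟩ : ℤ√(-(D : ℤ))) ^ n).im ^ 2 =
      (c ^ 2 + D) ^ n := by
  have h := Zsqrtd.norm_pow (⟨c, 1⟩ : ℤ√(-(D : ℤ))) n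
  rw [Zsqrtd.norm_def, Zsqrtd.norm_def] at h
  have h2 : c * c - -(D : ℤ) * 1 * 1 = c ^ 2 + D := by ring
  simp only [] at h
  rw [h2] at h
  linear_combination h

theorem im_one_pow_add_two (D n : ℕ) :
    ((⟨1, 1⟩ : ℤ√(-(D : ℤ))) ^ (n + 2)).im =
      2 * ((⟨1, 1⟩ : ℤ√(-(D : ℤ))) ^ (n + 1)).im - (1 + D) * ((⟨1, 1⟩ : ℤ√(-(D : ℤ))) ^ n).im := by
  rw [show n + 2 = n + 1 + 1 by ring, pow_succ _ (n + 1), pow_succ]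
  generalize (⟨1, 1⟩ : ℤ√(-(D : ℤ))) ^ n = z
  simp
  ring

theorem dvd_im_one_pow_sub (D n : ℕ) : (D : ℤ) ∣ ((⟨1, 1⟩ : ℤ√(-(D : ℤ))) ^ n).im - n := by
  induction n using Nat.twoStepInduction with
  | zero => simp
  | one => simp
  | more n ih1 ih2 =>
    rw [im_one_pow_add_two]
    obtain ⟨a, ha⟩ := ih1
    obtain ⟨b, hb⟩ := ih2
    refine ⟨2 * b - a - ((⟨1, 1⟩ : ℤ√(-(D : ℤ))) ^ n).im, ?_⟩
    push_cast at hb ⊢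
    linear_combination 2 * hb - ha

theorem dvd_im_one_pow_sub_two_pow (D n : ℕ) :
    (1 + D : ℤ) ∣ ((⟨1, 1⟩ : ℤ√(-(D : ℤ))) ^ (n + 1)).im - 2 ^ n := by
  induction n with
  | zero => simp
  | succ n ih =>
    rw [im_one_pow_add_two]
    obtain ⟨a, ha⟩ := ih
    exact ⟨2 * a - ((⟨1, 1⟩ : ℤ√(-(D : ℤ))) ^ n).im, by linear_combination 2 * ha⟩

/-- The linear recurrence `u (n + 2) = 2 u (n + 1) - Y u n` on pairs of consecutive terms, modulo
`56`. -/
def lucasStep (Y : ZMod 56) (p : ZMod 56 × ZMod 56) : ZMod 56 × ZMod 56 :=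
  (p.2, 2 * p.2 - Y * p.1)

theorem lucasStep_iterate (D n : ℕ) :
    (lucasStep ((1 + D : ℕ) : ZMod 56))^[n] (0, 1) =
      ((((⟨1, 1⟩ : ℤ√(-(D : ℤ))) ^ n).im : ZMod 56),
        (((⟨1, 1⟩ : ℤ√(-(D : ℤ))) ^ (n + 1)).im : ZMod 56)) := by
  induction n with
  | zero => simp
  | succ n ih =>
    rw [Function.iterate_succ_apply', ih, lucasStep, im_one_pow_add_two]
    push_cast
    rfl

set_option maxRecDepth 10000 in
/-- The recurrence has period `48` modulo `56` for the odd powers `Y` of `5`; within a period the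
value `-1` is not taken at exponents prime to `6`. -/
theorem lucasStep_ne_neg_one {Y : ZMod 56} (hY : Y = 5 ∨ Y = 13 ∨ Y = 45) {r : ℕ} (hr : Odd r)
    (h3 : ¬ 3 ∣ r) : ((lucasStep Y)^[r] (0, 1)).1 ≠ -1 := by
  have hper : Function.IsPeriodicPt (lucasStep Y) 48 (0, 1) := by
    rcases hY with rfl | rfl | rfl <;> (unfold Function.IsPeriodicPt Function.IsFixedPt; decide)
  rw [← hper.iterate_mod_apply]
  have hlt : r % 48 < 48 := Nat.mod_lt _ (by norm_num)
  have h1 : (r % 48) % 2 = 1 := by have := Nat.odd_iff.1 hr; omega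
  have h2 : (r % 48) % 3 ≠ 0 := by omega
  generalize r % 48 = s at hlt h1 h2
  revert s
  rcases hY with rfl | rfl | rfl <;> decide

/-- The value `-1` is where the prime power hypothesis on `1 + D` enters: since `D ∣ r + 1` and
`2 ^ (r - 1) ≡ -1 (mod 1 + D)`, Fermat's little theorem forces `1 + D` to be a power of `5`. Even
powers are excluded by the size of the norm, odd powers by a congruence modulo `56`. -/
theorem im_one_pow_ne_neg_one {D r : ℕ} (hD : Even D) (hD0 : 0 < D) (hr : Odd r) (hr1 : 1 < r)
    (hr3 : ¬ 3 ∣ r) (hpp : AtMostOnePrime (1 + D)) :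
    ((⟨1, 1⟩ : ℤ√(-(D : ℤ))) ^ r).im ≠ -1 := by
  intro h
  obtain ⟨q, b, hq, hqb⟩ := hpp.exists_natAbs_eq
  have hqb' : 1 + D = q ^ b := by rw [← hqb]; omega
  have hb0 : b ≠ 0 := by rintro rfl; simp at hqb'; omega
  have hqD : q ∣ 1 + D := hqb' ▸ dvd_pow_self q hb0
  have hq2 : q ≠ 2 := by
    rintro rfl; obtain ⟨a, rfl⟩ := hD; omega
  have hq5 : q = 5 := by
    have hfact := Fact.mk hq
    have h1 : (q : ℤ) ∣ (2 : ℤ) ^ (r - 1) + 1 := by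
      have := dvd_im_one_pow_sub_two_pow D (r - 1)
      rw [show r - 1 + 1 = r by omega, h] at this
      have h2 : (q : ℤ) ∣ 1 + D := by exact_mod_cast hqD
      have h3 := (h2.trans this).neg_right
      rwa [show -(-1 - (2 : ℤ) ^ (r - 1)) = 2 ^ (r - 1) + 1 by ring] at h3
    -- `q - 1` divides `q ^ b - 1 = D`, and `D` divides `im - r = -(r + 1)`
    have h2 : q - 1 ∣ r + 1 := by
      have h3 : (D : ℤ) ∣ ((r + 1 : ℕ) : ℤ) := by
        have := dvd_im_one_pow_sub D r
        rw [h] at this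
        have := this.neg_right
        push_cast
        rwa [show -(-1 - (r : ℤ)) = r + 1 by ring] at this
      have h4 : q - 1 ∣ D := by
        have : q - 1 ∣ q ^ b - 1 := by simpa using Nat.sub_dvd_pow_sub_pow q 1 b
        rwa [← hqb', Nat.add_sub_cancel_left] at this
      exact h4.trans (Int.natCast_dvd_natCast.1 h3)
    have h5 : ((2 : ℤ) ^ (r + 1) : ZMod q) = 1 := by
      obtain ⟨t, ht⟩ := h2
      have : ((2 : ℤ) : ZMod q) ≠ 0 := by
        rw [Ne, ZMod.intCast_zmod_eq_zero_iff_dvd]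
        intro h
        have := (Nat.prime_dvd_prime_iff_eq hq Nat.prime_two).1 (by exact_mod_cast h)
        exact hq2 this
      rw [ht, pow_mul, ZMod.pow_card_sub_one_eq_one this, one_pow]
    have h6 : (q : ℤ) ∣ 5 := by
      rw [← ZMod.intCast_zmod_eq_zero_iff_dvd] at h1 ⊢
      have h7 : (5 : ℤ) = 4 * (2 ^ (r - 1) + 1) - (2 ^ (r + 1) - 1) := by
        rw [show r + 1 = r - 1 + 2 by omega, pow_add]; ring
      rw [h7, Int.cast_sub, Int.cast_mul, h1]
      push_cast at h5 ⊢
      rw [h5]; ring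
    exact (Nat.prime_dvd_prime_iff_eq hq Nat.prime_five).1 (by exact_mod_cast h6)
  subst hq5
  rcases Nat.even_or_odd' b with ⟨a, rfl | rfl⟩
  -- if `1 + D = s²`, then `v² + D = (s ^ r)²` with `D < s ^ r`, too close for two squares
  · have hnorm := mk_one_pow_norm D 1 r
    rw [h] at hnorm
    generalize ((⟨1, 1⟩ : ℤ√(-(D : ℤ))) ^ r).re = v at hnorm
    have hD' : (1 + D : ℤ) = (5 ^ a) ^ 2 := by
      rw [← pow_mul, mul_comm a]; exact_mod_cast hqb'
    have hs1 : (1 : ℤ) < 5 ^ a := by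
      have : (0 : ℤ) < D := by exact_mod_cast hD0
      by_contra hle
      have : (0 : ℤ) < 5 ^ a := by positivity
      nlinarith
    generalize (5 : ℤ) ^ a = s at hD' hs1
    have h1 : v ^ 2 + s ^ 2 - 1 = (s ^ r) ^ 2 := by
      rw [← pow_mul, mul_comm r 2, pow_mul, ← hD']
      linear_combination hnorm
    have h2 : s ^ 2 ≤ s ^ r := pow_le_pow_right₀ hs1.le (by omega)
    have h3 : |v| < s ^ r := by
      apply abs_lt_of_sq_lt_sq _ (by positivity)
      nlinarith
    have h4 : v ^ 2 ≤ (s ^ r - 1) ^ 2 := by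
      rw [← sq_abs v]
      exact pow_le_pow_left₀ (abs_nonneg v) (by omega) 2
    nlinarith
  · have hY : ((1 + D : ℕ) : ZMod 56) = 5 ∨ ((1 + D : ℕ) : ZMod 56) = 13 ∨
        ((1 + D : ℕ) : ZMod 56) = 45 := by
      rw [hqb', pow_succ, pow_mul]
      push_cast
      have h3 : (25 : ZMod 56) ^ 3 = 1 := by decide
      rw [← Nat.div_add_mod a 3, pow_add, pow_mul (25 : ZMod 56), h3, one_pow]
      have : a % 3 < 3 := Nat.mod_lt _ (by norm_num)
      generalize a % 3 = s at this
      revert s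
      decide
    refine lucasStep_ne_neg_one hY hr hr3 ?_
    rw [lucasStep_iterate, h]
    simp

/-! ### Prime exponents `r ≥ 5` -/

theorem prime_dvd_of_dvd_im_pow {D r : ℕ} {c : ℤ} (hr : r.Prime) (hodd : Odd r)
    (h : (r : ℤ) ∣ ((⟨c, 1⟩ : ℤ√(-(D : ℤ))) ^ r).im) : r ∣ D := by
  have hdec : (⟨c, 1⟩ : ℤ√(-(D : ℤ))) = Zsqrtd.sqrtd + (c : ℤ√(-(D : ℤ))) := by ext <;> simp
  obtain ⟨w, hw⟩ := exists_add_pow_prime_eq hr (Zsqrtd.sqrtd : ℤ√(-(D : ℤ))) (c : ℤ√(-(D : ℤ)))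
  rw [← hdec, ← Int.cast_pow, mul_assoc, mul_assoc,
    show (r : ℤ√(-(D : ℤ))) = ((r : ℤ) : ℤ√(-(D : ℤ))) by simp] at hw
  rw [hw, Zsqrtd.im_add, Zsqrtd.im_add, Zsqrtd.im_intCast, Zsqrtd.sqrtd_pow_im, if_pos hodd,
    add_zero, Zsqrtd.im_smul, dvd_add_left (dvd_mul_right _ _)] at h
  exact Int.natCast_dvd_natCast.1
    (Int.dvd_neg.1 ((Nat.prime_iff_prime_int.1 hr).dvd_of_dvd_pow h))

/-- If `r ∣ D`, then `im ((c + √(-D)) ^ r)` is exactly divisible by `r`, unless `r ∣ c`. -/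
theorem prime_sq_dvd_im_pow_sub {D r : ℕ} {c : ℤ} (hr : r.Prime) (hr5 : 5 ≤ r) (hD : r ∣ D) :
    (r : ℤ) ^ 2 ∣ ((⟨c, 1⟩ : ℤ√(-(D : ℤ))) ^ r).im - c ^ (r - 1) * r := by
  have hodd : Odd r := hr.odd_of_ne_two (by omega)
  have hDz : (r : ℤ) ∣ -(D : ℤ) := (Int.natCast_dvd_natCast.2 hD).neg_right
  obtain ⟨k, rfl⟩ : ∃ k, r = k + 3 := ⟨r - 3, by omega⟩
  rw [Zsqrtd.mk_one_pow_im, Finset.sum_range_succ', Finset.sum_range_succ',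
    Finset.sum_range_succ']
  have hrest : ((k + 3 : ℕ) : ℤ) ^ 2 ∣ ∑ i ∈ Finset.range (k + 1),
      c ^ (k + 3 - (i + 1 + 1 + 1)) * ((k + 3).choose (i + 1 + 1 + 1) : ℤ) *
        (if Odd (i + 1 + 1 + 1) then (-(D : ℤ)) ^ ((i + 1 + 1 + 1) / 2) else 0) := by
    refine Finset.dvd_sum fun i hi => ?_
    split_ifs
    · rw [mul_assoc]
      refine Dvd.dvd.mul_left ?_ _
      have hi' := Finset.mem_range.1 hi
      rcases Nat.lt_or_ge (i + 1 + 1 + 1) (k + 3) with hlt | hge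
      · rw [sq]
        refine mul_dvd_mul ?_ (dvd_pow hDz (by omega))
        exact Int.natCast_dvd_natCast.2 (hr.dvd_choose_self (by omega) hlt)
      · exact Dvd.dvd.mul_left ((pow_dvd_pow_of_dvd hDz 2).trans (pow_dvd_pow _ (by omega))) _
    · simp
  generalize (∑ i ∈ Finset.range (k + 1),
      c ^ (k + 3 - (i + 1 + 1 + 1)) * ((k + 3).choose (i + 1 + 1 + 1) : ℤ) *
        (if Odd (i + 1 + 1 + 1) then (-(D : ℤ)) ^ ((i + 1 + 1 + 1) / 2) else 0)) = S at hrest ⊢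
  have h2 : ¬ Odd 2 := by decide
  simpa [h2] using hrest

theorem natAbs_im_pow_eq_one_or_eq {D r : ℕ} {c : ℤ} (hr : r.Prime) (hr5 : 5 ≤ r) (hcop : IsCoprime c D)
    (hU0 : ((⟨c, 1⟩ : ℤ√(-(D : ℤ))) ^ r).im ≠ 0)
    (hU : ∀ q : ℕ, q.Prime → (q : ℤ) ∣ ((⟨c, 1⟩ : ℤ√(-(D : ℤ))) ^ r).im → q = r) :
    ((⟨c, 1⟩ : ℤ√(-(D : ℤ))) ^ r).im.natAbs = 1 ∨
      ((⟨c, 1⟩ : ℤ√(-(D : ℤ))) ^ r).im.natAbs = r ∧ r ∣ D := by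
  have hodd : Odd r := hr.odd_of_ne_two (by omega)
  have hrz := Nat.prime_iff_prime_int.1 hr
  have hpow := Nat.eq_prime_pow_of_unique_prime_dvd (p := r) (Int.natAbs_ne_zero.2 hU0)
    (fun {d} hd hdz => hU d hd (Int.natCast_dvd.2 hdz))
  generalize ((⟨c, 1⟩ : ℤ√(-(D : ℤ))) ^ r).im.natAbs.primeFactorsList.length = j at hpow
  rcases Nat.eq_zero_or_pos j with rfl | hj
  · exact Or.inl (by simpa using hpow)
  right
  have hrU : (r : ℤ) ∣ ((⟨c, 1⟩ : ℤ√(-(D : ℤ))) ^ r).im := by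
    rw [Int.natCast_dvd, hpow]; exact dvd_pow_self r hj.ne'
  have hrD := prime_dvd_of_dvd_im_pow hr hodd hrU
  refine ⟨?_, hrD⟩
  have hj2 : j < 2 := by
    by_contra hj2
    have h2 : (r : ℤ) ^ 2 ∣ ((⟨c, 1⟩ : ℤ√(-(D : ℤ))) ^ r).im := by
      rw [← Int.natCast_pow, Int.natCast_dvd, hpow]; exact pow_dvd_pow r (by omega)
    have h3 := (dvd_sub_right h2).1 (prime_sq_dvd_im_pow_sub (c := c) hr hr5 hrD)
    rw [sq] at h3
    have h4 := Int.dvd_of_mul_dvd_mul_right hrz.ne_zero h3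
    have h5 := hrz.dvd_of_dvd_pow h4
    exact hrz.not_isUnit (hcop.isUnit_of_dvd' h5 (Int.natCast_dvd_natCast.2 hrD))
  rw [hpow, show j = 1 by omega, pow_one]

theorem sq_lt_three_pow {r : ℕ} (hr5 : 5 ≤ r) : r ^ 2 < 3 ^ (r - 1) := by
  induction r, hr5 using Nat.le_induction with
  | base => norm_num
  | succ r hr ih =>
    rw [show r + 1 - 1 = r - 1 + 1 by omega, pow_succ 3]
    have := Nat.mul_le_mul_right r hr
    nlinarith

theorem im_neg_one_pow (D : ℕ) {r : ℕ} (hr : Odd r) :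
    ((⟨-1, 1⟩ : ℤ√(-(D : ℤ))) ^ r).im = ((⟨1, 1⟩ : ℤ√(-(D : ℤ))) ^ r).im := by
  have h : (⟨-1, 1⟩ : ℤ√(-(D : ℤ))) = -star ⟨1, 1⟩ := by ext <;> simp
  rw [h, hr.neg_pow, ← star_pow, Zsqrtd.im_neg, Zsqrtd.im_star, neg_neg]

/-- The value `-r` is excluded modulo `r²`. If the value is `r`, then `C(r, 3) D` equals the sum of
the higher terms, all divisible by `r² D`, so that `r² ∣ C(r, 3)`, unless `r = 5`, where the last term
`D²` is the only one: then `D = 10`. -/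
theorem eq_ten_of_im_one_pow {D r : ℕ} (hr : r.Prime) (hr5 : 5 ≤ r) (hD0 : 0 < D) (hD : r ∣ D)
    (hU : ((⟨1, 1⟩ : ℤ√(-(D : ℤ))) ^ r).im.natAbs = r) : r = 5 ∧ D = 10 := by
  have hodd : Odd r := hr.odd_of_ne_two (by omega)
  have hrz := Nat.prime_iff_prime_int.1 hr
  have hsub := prime_sq_dvd_im_pow_sub (c := 1) hr hr5 hD
  have hU' : ((⟨1, 1⟩ : ℤ√(-(D : ℤ))) ^ r).im = r := by
    rcases Int.natAbs_eq ((⟨1, 1⟩ : ℤ√(-(D : ℤ))) ^ r).im with h | h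
    · rw [h, hU]
    · exfalso
      rw [h, hU, one_pow, one_mul, sq, show -(r : ℤ) - r = r * -2 by ring] at hsub
      have h2 := Int.dvd_of_mul_dvd_mul_left hrz.ne_zero hsub
      have h3 := Int.le_of_dvd (by norm_num) (Int.dvd_neg.1 h2)
      omega
  have hDz : (r : ℤ) ∣ -(D : ℤ) := (Int.natCast_dvd_natCast.2 hD).neg_right
  rw [Zsqrtd.mk_one_pow_im] at hU'
  rcases hr5.eq_or_lt with h5 | h5
  · subst h5
    refine ⟨rfl, ?_⟩
    have o3 : Odd 3 := by decide
    have o5 : Odd 5 := by decide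
    have e2 : ¬ Odd 2 := by decide
    have e4 : ¬ Odd 4 := by decide
    simp [Finset.sum_range_succ, o3, o5, e2, e4, Nat.choose] at hU'
    have h : (D : ℤ) * (D - 10) = 0 := by linear_combination hU'
    rcases mul_eq_zero.1 h with h | h <;> omega
  · exfalso
    have hr6 : r ≠ 6 := by rintro rfl; norm_num at hr
    obtain ⟨k, rfl⟩ : ∃ k, r = k + 5 := ⟨r - 5, by omega⟩
    rw [Finset.sum_range_succ', Finset.sum_range_succ',
      Finset.sum_range_succ', Finset.sum_range_succ', Finset.sum_range_succ'] at hU'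
    have hrest : ((k + 5 : ℕ) : ℤ) ^ 2 * (-(D : ℤ)) ∣ ∑ i ∈ Finset.range (k + 1),
        1 ^ (k + 5 - (i + 1 + 1 + 1 + 1 + 1)) * ((k + 5).choose (i + 1 + 1 + 1 + 1 + 1) : ℤ) *
          (if Odd (i + 1 + 1 + 1 + 1 + 1) then (-(D : ℤ)) ^ ((i + 1 + 1 + 1 + 1 + 1) / 2) else 0) := by
      refine Finset.dvd_sum fun i hi => ?_
      split_ifs
      · rw [one_pow, one_mul]
        have hi' := Finset.mem_range.1 hi
        obtain ⟨a, ha⟩ : ∃ a, (i + 1 + 1 + 1 + 1 + 1) / 2 = a + 2 :=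
          ⟨(i + 1 + 1 + 1 + 1 + 1) / 2 - 2, by omega⟩
        rcases Nat.lt_or_ge (i + 1 + 1 + 1 + 1 + 1) (k + 5) with hlt | hge
        · rw [sq, mul_assoc, ha]
          refine mul_dvd_mul ?_ ?_
          · exact Int.natCast_dvd_natCast.2 (hr.dvd_choose_self (by omega) hlt)
          · rw [pow_add, sq]
            exact Dvd.dvd.mul_left (mul_dvd_mul_right hDz _) _
        · refine Dvd.dvd.mul_left ?_ _
          rw [ha, pow_succ (-(D : ℤ)) (a + 1)]
          exact mul_dvd_mul_right
            ((pow_dvd_pow_of_dvd hDz 2).trans (pow_dvd_pow _ (show 2 ≤ a + 1 by omega))) _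
      · simp
    generalize (∑ i ∈ Finset.range (k + 1),
        1 ^ (k + 5 - (i + 1 + 1 + 1 + 1 + 1)) * ((k + 5).choose (i + 1 + 1 + 1 + 1 + 1) : ℤ) *
          (if Odd (i + 1 + 1 + 1 + 1 + 1) then (-(D : ℤ)) ^ ((i + 1 + 1 + 1 + 1 + 1) / 2)
            else 0)) = S at hrest hU'
    have h2 : ¬ Odd 2 := by decide
    have h3 : Odd 3 := by decide
    have h4 : ¬ Odd 4 := by decide
    simp [h2, h3, h4] at hU'
    have hD0' : -(D : ℤ) ≠ 0 := by omega
    obtain ⟨s, hs⟩ := hrest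
    have hch : ((k + 5).choose 3 : ℤ) = -((k + 5 : ℕ) : ℤ) ^ 2 * s := by
      apply mul_right_cancel₀ hD0'
      push_cast at hs ⊢
      linear_combination hU' - hs
    have h6 : ((k + 5).choose 3 : ℤ) * 6 = (k + 5) * (k + 4) * (k + 3) := by
      have h := Nat.descFactorial_eq_factorial_mul_choose (k + 5) 3
      simp [Nat.descFactorial, Nat.factorial] at h
      zify at h
      linear_combination -h
    have h7 : ((k + 5 : ℕ) : ℤ) ∣ (k + 4) * (k + 3) := by
      refine ⟨-6 * s, ?_⟩
      have : ((k + 5 : ℕ) : ℤ) ≠ 0 := by omega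
      apply mul_left_cancel₀ this
      push_cast at hch ⊢
      linear_combination 6 * hch - h6
    rcases hrz.dvd_or_dvd h7 with h | h
    · have := Int.le_of_dvd (by omega) h; omega
    · have := Int.le_of_dvd (by omega) h; omega

/-- The real part is divisible by `c`, with quotient `(2 k + 1) (-D) ^ k` modulo `c²`. -/
theorem exists_re_pow_eq_mul (D k : ℕ) (c : ℤ) :
    ∃ s, ((⟨c, 1⟩ : ℤ√(-(D : ℤ))) ^ (2 * k + 1)).re =
      c * ((2 * k + 1) * (-(D : ℤ)) ^ k + c ^ 2 * s) := by
  rw [Zsqrtd.mk_one_pow_re, Finset.sum_range_succ, Finset.sum_range_succ]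
  have hrest : c ^ 3 ∣ ∑ i ∈ Finset.range (2 * k), c ^ (2 * k + 1 - i) * ((2 * k + 1).choose i : ℤ) *
      (if Even i then (-(D : ℤ)) ^ (i / 2) else 0) := by
    refine Finset.dvd_sum fun i hi => ?_
    have hi' := Finset.mem_range.1 hi
    split_ifs with he
    · obtain ⟨a, rfl⟩ := he
      rw [mul_assoc]
      exact Dvd.dvd.mul_right (pow_dvd_pow _ (by omega)) _
    · simp
  obtain ⟨s, hs⟩ := hrest
  refine ⟨s, ?_⟩
  rw [hs]
  have h1 : ¬ Even (2 * k + 1) := by simp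
  have h2 : (2 * k + 1).choose (2 * k) = 2 * k + 1 := by simp
  rw [if_neg h1, if_pos (even_two_mul k), h2, show 2 * k + 1 - 2 * k = 1 by omega,
    show 2 * k / 2 = k by omega]
  push_cast
  ring

/-- If `c ≠ ±1`, then both coordinates of `(c + √(-D)) ^ r` are at most `r` times those of
`c + √(-D)`, which is absurd for the size of the norm. -/
theorem natAbs_eq_one_of_atMostOnePrime {D r : ℕ} {c : ℤ} (hr : r.Prime) (hr5 : 5 ≤ r)
    (hD2 : 2 ≤ D) (hcop : IsCoprime c D)
    (hV : AtMostOnePrime ((⟨c, 1⟩ : ℤ√(-(D : ℤ))) ^ r).re)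
    (hU : ((⟨c, 1⟩ : ℤ√(-(D : ℤ))) ^ r).im.natAbs ≤ r) : c.natAbs = 1 := by
  by_contra hc1
  have hodd : Odd r := hr.odd_of_ne_two (by omega)
  have hrz := Nat.prime_iff_prime_int.1 hr
  have hnorm := mk_one_pow_norm D c r
  obtain ⟨k, hk⟩ := hodd
  obtain ⟨s, hs⟩ := exists_re_pow_eq_mul D k c
  rw [← hk] at hs
  rw [hs] at hV hnorm
  have hkz : (2 * (k : ℤ) + 1) = r := by omega
  rw [hkz] at hV hnorm
  have hc0 : c ≠ 0 := left_ne_zero_of_mul hV.1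
  have hp := Nat.minFac_prime hc1
  have hpc : (c.natAbs.minFac : ℤ) ∣ c := Int.natCast_dvd.2 (Nat.minFac_dvd _)
  generalize c.natAbs.minFac = p at hp hpc
  have hpz := Nat.prime_iff_prime_int.1 hp
  have hpD : ¬ (p : ℤ) ∣ D := fun h => hpz.not_isUnit (hcop.isUnit_of_dvd' hpc h)
  -- the cofactor of `c` is a power of the prime `p ∣ c`, and `p` divides it only if `p = r`, once
  have hw : (r * (-(D : ℤ)) ^ k + c ^ 2 * s).natAbs ≤ r := by
    have hw0 := Int.natAbs_ne_zero.2 (right_ne_zero_of_mul hV.1)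
    have hpow := Nat.eq_prime_pow_of_unique_prime_dvd (p := p) hw0
      (fun {d} hd hdz => hV.2 d p hd hp ((Int.natCast_dvd.2 hdz).mul_left _) (hpc.mul_right _))
    generalize (r * (-(D : ℤ)) ^ k + c ^ 2 * s).natAbs.primeFactorsList.length = j at hpow
    rcases Nat.eq_zero_or_pos j with rfl | hj
    · rw [hpow, pow_zero]; omega
    have hpw : (p : ℤ) ∣ r * (-(D : ℤ)) ^ k + c ^ 2 * s := by
      rw [Int.natCast_dvd, hpow]; exact dvd_pow_self p hj.ne'
    have hpr : p = r := by
      have h1 := (dvd_add_left ((dvd_pow hpc two_ne_zero).mul_right s)).1 hpw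
      rcases hpz.dvd_or_dvd h1 with h | h
      · exact (Nat.prime_dvd_prime_iff_eq hp hr).1 (Int.natCast_dvd_natCast.1 h)
      · exact absurd (Int.dvd_neg.1 (hpz.dvd_of_dvd_pow h)) hpD
    subst hpr
    have hj2 : j < 2 := by
      by_contra hj2
      have h2 : (p : ℤ) ^ 2 ∣ p * (-(D : ℤ)) ^ k + c ^ 2 * s := by
        rw [← Int.natCast_pow, Int.natCast_dvd, hpow]; exact pow_dvd_pow p (by omega)
      have h3 := (dvd_add_left ((pow_dvd_pow_of_dvd hpc 2).mul_right s)).1 h2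
      rw [sq] at h3
      exact hpD (Int.dvd_neg.1 (hpz.dvd_of_dvd_pow (Int.dvd_of_mul_dvd_mul_left hpz.ne_zero h3)))
    rw [hpow, show j = 1 by omega, pow_one]
  generalize (r * (-(D : ℤ)) ^ k + c ^ 2 * s) = w at hw hnorm
  generalize ((⟨c, 1⟩ : ℤ√(-(D : ℤ))) ^ r).im = u at hU hnorm
  have sqle : ∀ a : ℤ, a.natAbs ≤ r → a ^ 2 ≤ r ^ 2 := fun a ha => by
    rw [← Int.natAbs_sq]; exact pow_le_pow_left₀ (by positivity) (by exact_mod_cast ha) 2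
  have hN3 : 3 ≤ c ^ 2 + D := by
    have : 0 < c ^ 2 := by positivity
    omega
  have h1 : (c ^ 2 + D) ^ r ≤ r ^ 2 * (c ^ 2 + D) := by
    rw [← hnorm]
    have := mul_le_mul_of_nonneg_left (sqle w hw) (sq_nonneg c)
    have := mul_le_mul_of_nonneg_left (sqle u hU) (Int.natCast_nonneg D)
    nlinarith
  have h2 : (c ^ 2 + D) ^ (r - 1) ≤ (r : ℤ) ^ 2 := by
    rw [show r = r - 1 + 1 by omega, pow_succ, ← show r = r - 1 + 1 by omega] at h1
    exact le_of_mul_le_mul_right h1 (by omega)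
  have h3 : (3 : ℤ) ^ (r - 1) ≤ (c ^ 2 + D) ^ (r - 1) := pow_le_pow_left₀ (by norm_num) hN3 _
  have h4 : (r : ℤ) ^ 2 < 3 ^ (r - 1) := by exact_mod_cast sq_lt_three_pow hr5
  omega

/-- The case of a prime exponent `r ≥ 5`: the only instance in which the imaginary part of
`(c + √(-D)) ^ r` has no prime factor besides `r` is `(±1 + √(-10)) ^ 5`. -/
theorem eq_ten_of_prime_exponent {D r : ℕ} {c : ℤ} (hr : r.Prime) (hr5 : 5 ≤ r)
    (hD : Even D) (hD0 : 0 < D) (hcop : IsCoprime c D)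
    (hV : AtMostOnePrime ((⟨c, 1⟩ : ℤ√(-(D : ℤ))) ^ r).re)
    (hN : AtMostOnePrime (c ^ 2 + D))
    (hU0 : ((⟨c, 1⟩ : ℤ√(-(D : ℤ))) ^ r).im ≠ 0)
    (hU : ∀ q : ℕ, q.Prime → (q : ℤ) ∣ ((⟨c, 1⟩ : ℤ√(-(D : ℤ))) ^ r).im → q = r) :
    r = 5 ∧ D = 10 ∧ c.natAbs = 1 := by
  have hodd : Odd r := hr.odd_of_ne_two (by omega)
  have hU1 := natAbs_im_pow_eq_one_or_eq hr hr5 hcop hU0 hU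
  have hD2 : 2 ≤ D := by obtain ⟨a, rfl⟩ := hD; omega
  have hc := natAbs_eq_one_of_atMostOnePrime hr hr5 hD2 hcop hV (by omega)
  have himeq : ((⟨c, 1⟩ : ℤ√(-(D : ℤ))) ^ r).im = ((⟨1, 1⟩ : ℤ√(-(D : ℤ))) ^ r).im := by
    rcases Int.natAbs_eq_iff.1 hc with h | h
    · rw [h]; rfl
    · rw [h]; exact im_neg_one_pow D hodd
  have hc2 : c ^ 2 = 1 := by rw [← Int.natAbs_sq, hc]; norm_num
  rw [hc2] at hN
  rw [himeq] at hU1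
  rcases hU1 with h | ⟨h, hrD⟩
  · exfalso
    rcases Int.natAbs_eq_iff.1 h with h | h
    · exact im_one_pow_ne_one hD hD0 hodd hr5 h
    · refine im_one_pow_ne_neg_one hD hD0 hodd hr.one_lt (fun h3 => ?_) hN h
      have := (Nat.prime_dvd_prime_iff_eq Nat.prime_three hr).1 h3
      omega
  · obtain ⟨h1, h2⟩ := eq_ten_of_im_one_pow hr hr5 hD0 hrD h
    exact ⟨h1, h2, hc⟩

/-! ### Integers of the imaginary quadratic field `ℚ(√(-P))` -/

/-- The square root `√(-P) = i√P` as a complex number. -/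
noncomputable def sqrtNeg (P : ℕ) : ℂ := Complex.I * (Real.sqrt (P : ℝ) : ℂ)

theorem sqrtNeg_sq (P : ℕ) : sqrtNeg P * sqrtNeg P = ((-(P : ℤ) : ℤ) : ℂ) := by
  have h : ((Real.sqrt (P : ℝ) : ℝ) : ℂ) * (Real.sqrt (P : ℝ) : ℝ) = (P : ℂ) := by
    rw [← Complex.ofReal_mul, Real.mul_self_sqrt (Nat.cast_nonneg P)]; simp
  rw [sqrtNeg, mul_mul_mul_comm, h, Complex.I_mul_I]; push_cast; ring

theorem conj_sqrtNeg (P : ℕ) : (starRingEnd ℂ) (sqrtNeg P) = -sqrtNeg P := by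
  simp [sqrtNeg]

theorem sqrtNeg_isIntegral (P : ℕ) : IsIntegral ℤ (sqrtNeg P) := by
  refine IsIntegral.of_pow (n := 2) (by norm_num) ?_
  rw [sq, sqrtNeg_sq]
  exact isIntegral_algebraMap (R := ℤ) (A := ℂ)

theorem sqrtNeg_mem (P : ℕ) : sqrtNeg P ∈ imagQuadField P :=
  IntermediateField.subset_adjoin ℚ _ rfl

/-- The embedding of `ℤ[√(-P)]` in `ℂ`. -/
noncomputable def zsqrtdHom (P : ℕ) : ℤ√(-(P : ℤ)) →+* ℂ :=
  Zsqrtd.lift ⟨sqrtNeg P, sqrtNeg_sq P⟩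

theorem zsqrtdHom_mk (P : ℕ) (a b : ℤ) : zsqrtdHom P ⟨a, b⟩ = a + b * sqrtNeg P := rfl

theorem zsqrtdHom_injective {P : ℕ} (hP : 0 < P) : Function.Injective (zsqrtdHom P) :=
  Zsqrtd.lift_injective _ fun n h => by
    have h1 : (0 : ℤ) < P := by exact_mod_cast hP
    nlinarith [mul_self_nonneg n]

theorem add_mul_sqrtNeg_inj {P : ℕ} (hP : 0 < P) {a b a' b' : ℤ}
    (h : (a : ℂ) + b * sqrtNeg P = a' + b' * sqrtNeg P) : a = a' ∧ b = b' := by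
  have := zsqrtdHom_injective hP (a₁ := ⟨a, b⟩) (a₂ := ⟨a', b'⟩) h
  simpa using this

theorem normSq_add_mul_sqrtNeg (P : ℕ) (a b : ℝ) :
    Complex.normSq ((a : ℂ) + b * sqrtNeg P) = a ^ 2 + P * b ^ 2 := by
  have h : ((Real.sqrt (P : ℝ))) * (Real.sqrt (P : ℝ)) = P :=
    Real.mul_self_sqrt (Nat.cast_nonneg P)
  simp [sqrtNeg, Complex.normSq_apply]
  linear_combination b ^ 2 * h

instance (P : ℕ) : NumberField (imagQuadField P) where
  to_finiteDimensional :=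
    IntermediateField.adjoin.finiteDimensional
      ((sqrtNeg_isIntegral P).tower_top (A := ℚ))

theorem exists_rat_of_mem {P : ℕ} {z : ℂ} (hz : z ∈ imagQuadField P) :
    ∃ s t : ℚ, z = s + t * sqrtNeg P := by
  have h1 : z ∈ Algebra.adjoin ℚ {sqrtNeg P} := by
    have := IntermediateField.adjoin_simple_toSubalgebra_of_isAlgebraic
      ((sqrtNeg_isIntegral P).tower_top (A := ℚ)).isAlgebraic
    rw [← this]
    exact hz
  clear hz
  have hs := sqrtNeg_sq P
  push_cast at hs
  induction h1 using Algebra.adjoin_induction with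
  | mem x hx => exact ⟨0, 1, by simp at hx; simp [hx]⟩
  | algebraMap r => exact ⟨r, 0, by simp⟩
  | add x y _ _ hx hy =>
    obtain ⟨s, t, rfl⟩ := hx
    obtain ⟨s', t', rfl⟩ := hy
    exact ⟨s + s', t + t', by push_cast; ring⟩
  | mul x y _ _ hx hy =>
    obtain ⟨s, t, rfl⟩ := hx
    obtain ⟨s', t', rfl⟩ := hy
    exact ⟨s * s' - P * t * t', s * t' + t * s', by push_cast; linear_combination (t * t' : ℂ) * hs⟩

theorem rat_of_isIntegral {q : ℚ} (h : IsIntegral ℤ (q : ℂ)) : ∃ n : ℤ, q = n := by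
  have h1 : IsIntegral ℤ q :=
    (isIntegral_algebraMap_iff (algebraMap ℚ ℂ).injective).1 (by simpa using h)
  obtain ⟨n, hn⟩ := IsIntegrallyClosed.isIntegral_iff.1 h1
  exact ⟨n, by simpa using hn.symm⟩

theorem rat_int_of_squarefree_mul_sq {P : ℕ} (hP : Squarefree P) {t : ℚ} {m : ℤ}
    (h : P * t ^ 2 = m) : ∃ n : ℤ, t = n := by
  have h1 : (t.den : ℤ) * t.den ∣ P * t.num ^ 2 := by
    refine ⟨m, ?_⟩
    have h2 : (t.den : ℚ) ≠ 0 := by exact_mod_cast t.den_ne_zero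
    have h3 : t * t.den = t.num := Rat.mul_den_eq_num t
    have : ((P : ℚ) * t.num ^ 2) = t.den * t.den * m := by
      rw [← h3, ← h]; ring
    exact_mod_cast this
  have h2 : IsCoprime ((t.den : ℤ) * t.den) (t.num ^ 2) := by
    have h3 : IsCoprime (t.den : ℤ) t.num := by
      rw [isCoprime_comm, Int.isCoprime_iff_gcd_eq_one]
      exact t.reduced
    exact (h3.mul_left h3).pow_right
  have h4 : t.den * t.den ∣ P := by exact_mod_cast h2.dvd_of_dvd_mul_right h1
  have h5 : t.den = 1 := Nat.isUnit_iff.1 (hP _ h4)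
  exact ⟨t.num, (Rat.den_eq_one_iff t).1 h5 |>.symm⟩

/-- An integer of the field has the form `(A + B√(-P)) / 2`; its norm `N` is its absolute value
squared. -/
theorem exists_int_of_isIntegral {P : ℕ} (hP : Squarefree P) {z : ℂ}
    (hz : z ∈ imagQuadField P) (hi : IsIntegral ℤ z) :
    ∃ A B N : ℤ, 2 * z = A + B * sqrtNeg P ∧ A ^ 2 + P * B ^ 2 = 4 * N ∧
      Complex.normSq z = N := by
  obtain ⟨s, t, rfl⟩ := exists_rat_of_mem hz
  have hconj : (starRingEnd ℂ) ((s : ℂ) + t * sqrtNeg P) = s - t * sqrtNeg P := by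
    simp [conj_sqrtNeg, sub_eq_add_neg]
  have hi' : IsIntegral ℤ ((s : ℂ) - t * sqrtNeg P) := by
    rw [← hconj]
    exact hi.map (starRingEnd ℂ).toIntAlgHom
  obtain ⟨A, hA⟩ := rat_of_isIntegral (q := 2 * s) (by
    have h : ((2 * s : ℚ) : ℂ) = (s + t * sqrtNeg P) + (s - t * sqrtNeg P) := by push_cast; ring
    rw [h]; exact hi.add hi')
  have hs := sqrtNeg_sq P
  push_cast at hs
  obtain ⟨N, hN⟩ := rat_of_isIntegral (q := s ^ 2 + P * t ^ 2) (by
    have h : ((s ^ 2 + P * t ^ 2 : ℚ) : ℂ) = (s + t * sqrtNeg P) * (s - t * sqrtNeg P) := by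
      push_cast; linear_combination (t : ℂ) ^ 2 * hs
    rw [h]; exact hi.mul hi')
  obtain ⟨B, hB⟩ := rat_int_of_squarefree_mul_sq hP (t := 2 * t) (m := 4 * N - A ^ 2) (by
    push_cast; rw [← hA, ← hN]; ring)
  refine ⟨A, B, N, ?_, ?_, ?_⟩
  · have hA' : (2 : ℂ) * s = A := by exact_mod_cast congrArg (Rat.cast : ℚ → ℂ) hA
    have hB' : (2 : ℂ) * t = B := by exact_mod_cast congrArg (Rat.cast : ℚ → ℂ) hB
    rw [← hA', ← hB']; ring
  · have : ((A : ℚ) ^ 2 + P * B ^ 2) = 4 * N := by rw [← hA, ← hB, ← hN]; ring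
    exact_mod_cast this
  · have h1 := normSq_add_mul_sqrtNeg P s t
    push_cast at h1
    rw [h1]
    exact_mod_cast congrArg (Rat.cast : ℚ → ℝ) hN

/-! ### Extraction of powers: ideals and units -/

open scoped NumberField in
/-- Since `x + k√(-P)` and its conjugate are coprime, `x + k√(-P)` generates the `n`-th power of an
ideal `I`. If `h` is an exponent of the class group, then `I ^ gcd n h` is principal, so `x + k√(-P)`
is a unit times a power with exponent `n / gcd n h`. -/
theorem exists_unit_mul_pow {P : ℕ} (hP : Squarefree P) {x k y : ℤ} {n h : ℕ} (hn : 0 < n)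
    (hh : ∀ I : Ideal (𝓞 (imagQuadField P)), (I ^ h).IsPrincipal)
    (heq : x ^ 2 + P * k ^ 2 = y ^ n) (hcop : IsCoprime (2 * x) y) (hy0 : y ≠ 0) :
    ∃ α ε : ℂ, (α ∈ imagQuadField P ∧ IsIntegral ℤ α) ∧ (ε ∈ imagQuadField P ∧ IsIntegral ℤ ε) ∧
      Complex.normSq ε = 1 ∧ (x : ℂ) + k * sqrtNeg P = ε * α ^ (n / n.gcd h) := by
  set K := imagQuadField P with hK
  let w : 𝓞 K := ⟨⟨sqrtNeg P, sqrtNeg_mem P⟩,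
    (isIntegral_algHom_iff (K.val.restrictScalars ℤ) K.val.injective).1 (sqrtNeg_isIntegral P)⟩
  have toC (z : 𝓞 K) : IsIntegral ℤ ((z : K) : ℂ) :=
    (isIntegral_algHom_iff (K.val.restrictScalars ℤ) K.val.injective).2 z.2
  have hwC : ((w : K) : ℂ) = sqrtNeg P := rfl
  have hw : w * w = -(P : 𝓞 K) := by
    apply NumberField.RingOfIntegers.ext
    apply Subtype.ext
    have := sqrtNeg_sq P
    push_cast at this
    simpa [hwC] using this
  set θ : 𝓞 K := x + k * w with hθ
  set θ' : 𝓞 K := x - k * w with hθ'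
  have hmul : θ * θ' = (y : 𝓞 K) ^ n := by
    have h1 : ((x ^ 2 + P * k ^ 2 : ℤ) : 𝓞 K) = ((y ^ n : ℤ) : 𝓞 K) := by rw [heq]
    push_cast at h1
    rw [← h1, hθ, hθ']
    linear_combination -(k : 𝓞 K) ^ 2 * hw
  have hcop' : IsCoprime (Ideal.span {θ}) (Ideal.span {θ'}) := by
    rw [Ideal.isCoprime_span_singleton_iff]
    have h1 : IsCoprime ((2 * x : ℤ) : 𝓞 K) ((y ^ n : ℤ) : 𝓞 K) :=
      (hcop.pow_right (n := n)).map (Int.castRingHom (𝓞 K))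
    obtain ⟨a, b, hab⟩ := h1
    push_cast at hab
    refine ⟨a + b * θ', a, ?_⟩
    rw [← hab, ← hmul, hθ, hθ']
    ring
  have hspan : Ideal.span {θ} * Ideal.span {θ'} = (Ideal.span {(y : 𝓞 K)}) ^ n := by
    rw [Ideal.span_singleton_mul_span_singleton, Ideal.span_singleton_pow, hmul]
  let _ : GCDMonoid (Ideal (𝓞 K)) := UniqueFactorizationMonoid.toGCDMonoid _
  obtain ⟨I, hI⟩ := exists_eq_pow_of_mul_eq_pow_of_coprime hcop' hspan
  have hθ0 : θ ≠ 0 := by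
    intro h0
    rw [h0, zero_mul] at hmul
    exact pow_ne_zero n (Int.cast_ne_zero.2 hy0) hmul.symm
  have hI0 : I ≠ 0 := by
    rintro rfl
    rw [zero_pow hn.ne'] at hI
    exact hθ0 (Ideal.span_singleton_eq_bot.1 hI)
  have hIm : I ∈ nonZeroDivisors (Ideal (𝓞 K)) := mem_nonZeroDivisors_of_ne_zero hI0
  have hcl (j : ℕ) : ClassGroup.mk0 ⟨I, hIm⟩ ^ j = 1 ↔ (I ^ j).IsPrincipal := by
    rw [← map_pow, ClassGroup.mk0_eq_one_iff]
    rfl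
  have hg : (I ^ n.gcd h).IsPrincipal := by
    rw [← hcl, pow_gcd_eq_one]
    exact ⟨(hcl n).2 ⟨⟨θ, hI.symm⟩⟩, (hcl h).2 (hh I)⟩
  obtain ⟨a, ha⟩ := hg.principal
  have hspan2 : Ideal.span {a ^ (n / n.gcd h)} = Ideal.span {θ} := by
    rw [← Ideal.span_singleton_pow, hI]
    change Submodule.span _ _ ^ _ = _
    rw [← ha, ← pow_mul, Nat.mul_div_cancel' (Nat.gcd_dvd_left n h)]
  obtain ⟨u, hu⟩ := Ideal.span_singleton_eq_span_singleton.1 hspan2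
  refine ⟨((a : K) : ℂ), (((u : 𝓞 K) : K) : ℂ), ⟨(a : K).2, toC a⟩, ⟨((u : 𝓞 K) : K).2, toC u⟩,
    ?_, ?_⟩
  · obtain ⟨_, _, N, _, _, hN⟩ := exists_int_of_isIntegral hP ((u : 𝓞 K) : K).2 (toC u)
    obtain ⟨_, _, M, _, _, hM⟩ := exists_int_of_isIntegral hP (((u⁻¹ : (𝓞 K)ˣ) : 𝓞 K) : K).2
      (toC ((u⁻¹ : (𝓞 K)ˣ) : 𝓞 K))
    have h1 : (((u : 𝓞 K) : K) : ℂ) * ((((u⁻¹ : (𝓞 K)ˣ) : 𝓞 K) : K) : ℂ) = 1 := by simp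
    have h2 := congrArg Complex.normSq h1
    rw [Complex.normSq_mul, hN, hM, Complex.normSq_one] at h2
    have h3 : N * M = 1 := by exact_mod_cast h2
    have h4 : 0 ≤ N := by
      have := Complex.normSq_nonneg (((u : 𝓞 K) : K) : ℂ)
      rw [hN] at this
      exact_mod_cast this
    rw [hN, Int.eq_one_or_neg_one_of_mul_eq_one h3 |>.resolve_right (by omega)]
    simp
  · have h3 := congrArg (fun z : 𝓞 K => ((z : K) : ℂ)) hu
    simp only [hθ] at h3
    simp [hwC] at h3
    rw [← h3, mul_comm]

theorem norm_mk_neg (P : ℕ) (a b : ℤ) : (⟨a, b⟩ : ℤ√(-(P : ℤ))).norm = a ^ 2 + P * b ^ 2 := by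
  rw [Zsqrtd.norm_def]; ring

theorem normSq_zsqrtdHom (P : ℕ) (z : ℤ√(-(P : ℤ))) :
    Complex.normSq (zsqrtdHom P z) = z.norm := by
  obtain ⟨a, b⟩ := z
  have := normSq_add_mul_sqrtNeg P a b
  push_cast at this
  rw [zsqrtdHom_mk, this, norm_mk_neg]
  push_cast
  rfl

/-- A unit of norm one is `±1`, or `±i`, or `(±1 ± √(-3)) / 2`. -/
theorem unit_cases {P : ℕ} (hP : Squarefree P) {ε : ℂ} (hε : ε ∈ imagQuadField P)
    (hεi : IsIntegral ℤ ε) (hε1 : Complex.normSq ε = 1) :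
    (ε = 1 ∨ ε = -1) ∨ (P = 1 ∧ (ε = sqrtNeg P ∨ ε = -sqrtNeg P)) ∨
      (P = 3 ∧ ∃ E F : ℤ, Odd E ∧ Odd F ∧ 2 * ε = E + F * sqrtNeg P) := by
  obtain ⟨E, F, N, hEF, hN, hN1⟩ := exists_int_of_isIntegral hP hε hεi
  rw [hε1] at hN1
  have hN1' : N = 1 := by exact_mod_cast hN1.symm
  subst hN1'
  have hP0 : 0 < P := Nat.pos_of_ne_zero hP.ne_zero
  have hP4 : P ≠ 4 := by
    rintro rfl
    have := hP 2 ⟨1, by norm_num⟩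
    simp at this
  have h2 : (2 : ℂ) ≠ 0 := two_ne_zero
  have hE4 : E ^ 2 ≤ 4 := by nlinarith [mul_nonneg (Int.natCast_nonneg P) (sq_nonneg F)]
  have hE : -2 ≤ E ∧ E ≤ 2 := by constructor <;> nlinarith
  by_cases hF : F = 0
  · subst hF
    left
    obtain ⟨hE1, hE2⟩ := hE
    have : E = 2 ∨ E = -2 := by
      interval_cases E <;> simp at hN ⊢
    rcases this with rfl | rfl
    · left; apply mul_left_cancel₀ h2; rw [hEF]; simp
    · right; apply mul_left_cancel₀ h2; rw [hEF]; simp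
  · right
    have hF2 : F ^ 2 ≤ 4 := by
      have : (1 : ℤ) ≤ P := by exact_mod_cast hP0
      nlinarith [sq_nonneg E, sq_nonneg F]
    have hF1 : 1 ≤ F ^ 2 := by
      have : 0 < F ^ 2 := by positivity
      omega
    have hPle : P ≤ 4 := by
      have : (P : ℤ) ≤ 4 := by
        nlinarith [sq_nonneg E, mul_le_mul_of_nonneg_left hF1 (Int.natCast_nonneg P)]
      exact_mod_cast this
    have hF : -2 ≤ F ∧ F ≤ 2 := by constructor <;> nlinarith
    obtain ⟨hE1, hE2⟩ := hE
    obtain ⟨hF1', hF2'⟩ := hF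
    have hcase : (P = 1 ∧ E = 0 ∧ (F = 2 ∨ F = -2)) ∨ (P = 3 ∧ Odd E ∧ Odd F) := by
      interval_cases P <;> interval_cases E <;> interval_cases F <;>
        simp +decide at hN hP4 hF1 ⊢
    rcases hcase with ⟨rfl, rfl, rfl | rfl⟩ | ⟨rfl, hE, hF⟩
    · left; refine ⟨rfl, Or.inl ?_⟩; apply mul_left_cancel₀ h2; rw [hEF]; simp
    · left; refine ⟨rfl, Or.inr ?_⟩; apply mul_left_cancel₀ h2; rw [hEF]; simp
    · right; exact ⟨rfl, E, F, hE, hF, hEF⟩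

/-- If `x + k√(-P)` is a unit times `g ^ m` with `g` in `ℤ[√(-P)]`, then `±(x + k√(-P))` is an
`m`-th power in `ℤ[√(-P)]`. For `P = 1` and even `m`, the units `±i` would make `x` even; for `P = 3`
the units outside `ℤ[√(-3)]` would move `g ^ m`, whose norm is odd, out of `ℤ[√(-3)]`. -/
theorem exists_pow_eq_of_mem {P : ℕ} (hP : Squarefree P) {x k : ℤ} {m : ℕ}
    (hodd : Odd (x ^ 2 + P * k ^ 2)) (hP1 : P = 1 → Odd x) {ε : ℂ} (hε : ε ∈ imagQuadField P)
    (hεi : IsIntegral ℤ ε) (hε1 : Complex.normSq ε = 1) (g : ℤ√(-(P : ℤ)))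
    (h : (x : ℂ) + k * sqrtNeg P = ε * (zsqrtdHom P g) ^ m) :
    ∃ g' : ℤ√(-(P : ℤ)), g' ^ m = ⟨x, k⟩ ∨ g' ^ m = -⟨x, k⟩ := by
  have hP0 : 0 < P := Nat.pos_of_ne_zero hP.ne_zero
  have hinj := zsqrtdHom_injective hP0
  rw [← zsqrtdHom_mk, ← map_pow] at h
  rcases unit_cases hP hε hεi hε1 with (rfl | rfl) | ⟨rfl, hεδ⟩ | ⟨rfl, E, F, hE, hF, hEF⟩
  · exact ⟨g, Or.inl (hinj (by rw [h, one_mul]))⟩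
  · exact ⟨g, Or.inr (hinj (by rw [map_neg, h]; ring))⟩
  · have hx := hP1 rfl
    have hi : zsqrtdHom 1 ⟨0, 1⟩ = sqrtNeg 1 := by rw [zsqrtdHom_mk]; simp
    have h' : (⟨x, k⟩ : ℤ√(-((1 : ℕ) : ℤ))) = ⟨0, 1⟩ * g ^ m ∨
        (⟨x, k⟩ : ℤ√(-((1 : ℕ) : ℤ))) = -(⟨0, 1⟩ * g ^ m) := by
      rcases hεδ with h0 | h0
      · left; apply hinj; rw [h, map_mul, hi, h0]
      · right; apply hinj; rw [h, map_neg, map_mul, hi, h0]; ring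
    rcases Nat.even_or_odd' m with ⟨j, rfl | rfl⟩
    · exfalso
      rw [mul_comm 2 j, pow_mul, sq] at h'
      generalize g ^ j = z at h'
      have hev : Even x := by
        rcases h' with h' | h'
        · have := congrArg Zsqrtd.re h'
          simp at this
          rw [this]; exact ⟨-(z.re * z.im), by ring⟩
        · have := congrArg Zsqrtd.re h'
          simp at this
          rw [this]; exact ⟨(z.re * z.im), by ring⟩
      exact (Int.not_even_iff_odd.2 hx) hev
    · refine ⟨⟨0, 1⟩ * g, ?_⟩
      have hi2 : (⟨0, 1⟩ : ℤ√(-((1 : ℕ) : ℤ))) ^ 2 = -1 := by rw [sq]; ext <;> simp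
      have hpow : ((⟨0, 1⟩ : ℤ√(-((1 : ℕ) : ℤ))) * g) ^ (2 * j + 1) =
          (-1) ^ j * (⟨0, 1⟩ * g ^ (2 * j + 1)) := by
        rw [mul_pow, pow_succ (⟨0, 1⟩ : ℤ√(-((1 : ℕ) : ℤ))), pow_mul, hi2]; ring
      rw [hpow]
      rcases neg_one_pow_eq_or (ℤ√(-((1 : ℕ) : ℤ))) j with h1 | h1 <;> rw [h1] <;>
        rcases h' with h' | h' <;> rw [h'] <;> simp
  · exfalso
    generalize hz : g ^ m = z at h
    obtain ⟨c, d⟩ := z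
    have hnorm : x ^ 2 + (3 : ℕ) * k ^ 2 = c ^ 2 + 3 * d ^ 2 := by
      have := congrArg Complex.normSq h
      rw [Complex.normSq_mul, hε1, one_mul, normSq_zsqrtdHom, normSq_zsqrtdHom, norm_mk_neg,
        norm_mk_neg] at this
      exact_mod_cast this
    have hs := sqrtNeg_sq 3
    push_cast at hs
    have h2 : ((2 * x : ℤ) : ℂ) + (2 * k : ℤ) * sqrtNeg 3 =
        (E * c - 3 * F * d : ℤ) + (E * d + F * c : ℤ) * sqrtNeg 3 := by
      rw [zsqrtdHom_mk, zsqrtdHom_mk] at h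
      push_cast
      linear_combination 2 * h + (c + d * sqrtNeg 3) * hEF + F * d * hs
    have h3 := (add_mul_sqrtNeg_inj (by norm_num) h2).1
    rw [hnorm] at hodd
    obtain ⟨E, rfl⟩ := hE
    obtain ⟨F, rfl⟩ := hF
    have h4 : Even (c + d) := ⟨x - E * c + 3 * F * d + 2 * d, by linear_combination -h3⟩
    have h5 : Odd (c + d) := by
      simp [Int.odd_add, Int.odd_pow, Int.even_mul, Int.even_pow] at hodd ⊢
      simpa [show ¬ Even (3 : ℤ) by decide] using hodd
    exact (Int.not_even_iff_odd.2 h5) h4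

/-! ### Extraction of powers: half-integers -/

theorem sq_mod_eight_of_odd {a : ℤ} (h : Odd a) : a ^ 2 % 8 = 1 := by
  obtain ⟨k, rfl⟩ := h
  obtain ⟨t, ht⟩ := Int.even_mul_succ_self k
  have : (2 * k + 1) ^ 2 = 8 * t + 1 := by linear_combination 4 * ht
  omega

/-- An integer of `ℚ(√(-P))` outside `ℤ[√(-P)]` with odd norm exists only for `P ≡ 3 (mod 8)`. -/
theorem odd_of_not_even {P : ℕ} (hP : Squarefree P) {A B N : ℤ} (hN : A ^ 2 + P * B ^ 2 = 4 * N)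
    (hodd : Odd N) (h : ¬ (Even A ∧ Even B)) : Odd A ∧ Odd B ∧ P % 8 = 3 := by
  have hP4 : ¬ (4 : ℤ) ∣ P := by
    intro h4
    have h4' : 2 * 2 ∣ P := by exact_mod_cast h4
    have := hP 2 h4'
    simp at this
  rcases Int.even_or_odd A with hA | hA <;> rcases Int.even_or_odd B with hB | hB
  · exact absurd ⟨hA, hB⟩ h
  · exfalso
    obtain ⟨a, rfl⟩ := hA
    obtain ⟨b, rfl⟩ := hB
    apply hP4
    exact ⟨N - a ^ 2 - P * (b ^ 2 + b), by linear_combination hN⟩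
  · exfalso
    obtain ⟨b, rfl⟩ := hB
    obtain ⟨a, rfl⟩ := hA
    have : 4 * (a ^ 2 + a + P * b ^ 2 - N) = -1 := by linear_combination hN
    omega
  · refine ⟨hA, hB, ?_⟩
    have h1 := sq_mod_eight_of_odd hA
    have h2 := sq_mod_eight_of_odd hB
    obtain ⟨n, rfl⟩ := hodd
    obtain ⟨s, hs⟩ : ∃ s, B ^ 2 = 8 * s + 1 := ⟨B ^ 2 / 8, by omega⟩
    obtain ⟨t, ht⟩ : ∃ t, A ^ 2 = 8 * t + 1 := ⟨A ^ 2 / 8, by omega⟩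
    rw [hs, ht] at hN
    have : (P : ℤ) = 8 * (n - t - P * s) + 3 := by linear_combination hN
    generalize (P : ℤ) * s = q at this
    omega

theorem odd_add_of_odd_norm {P : ℕ} (hP : Odd P) {c d : ℤ} (h : Odd (c ^ 2 + P * d ^ 2)) :
    Odd (c + d) := by
  have hP' : ¬ Even (P : ℤ) := by
    rw [Int.even_coe_nat, Nat.not_even_iff_odd]; exact hP
  simp only [Int.odd_add, Int.odd_pow, Int.even_mul, Int.even_pow, hP', false_or] at h ⊢
  simpa using h

/-- For `P = 3` every integer of the field is a unit times an element of `ℤ[√(-3)]`. -/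
theorem exists_unit_mul_eq_zsqrtd {α : ℂ} {A B : ℤ} (hA : Odd A) (hB : Odd B)
    (h : 2 * α = A + B * sqrtNeg 3) :
    ∃ (ε : ℂ) (g : ℤ√(-((3 : ℕ) : ℤ))), ε ∈ imagQuadField 3 ∧ IsIntegral ℤ ε ∧
      Complex.normSq ε = 1 ∧ α = ε * zsqrtdHom 3 g := by
  have hs := sqrtNeg_sq 3
  push_cast at hs
  obtain ⟨s, hs1, a, ha⟩ : ∃ s : ℤ, s ^ 2 = 1 ∧ ∃ a, A + s * B = 4 * a := by
    obtain ⟨a, rfl⟩ := hA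
    obtain ⟨b, rfl⟩ := hB
    rcases Int.even_or_odd (a + b) with ⟨c, hc⟩ | ⟨c, hc⟩
    · exact ⟨-1, by norm_num, a - c, by linear_combination -2 * hc⟩
    · exact ⟨1, by norm_num, c + 1, by linear_combination 2 * hc⟩
  have hs1' : (s : ℂ) ^ 2 = 1 := by exact_mod_cast hs1
  have ha' : (A : ℂ) + s * B = 4 * a := by exact_mod_cast ha
  refine ⟨(1 - s * sqrtNeg 3) / 2, ⟨a - s * B, s * a⟩, ?_, ?_, ?_, ?_⟩
  · have h2 : (2 : ℂ) ∈ imagQuadField 3 := ofNat_mem _ 2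
    exact div_mem (sub_mem (one_mem _) (mul_mem (intCast_mem _ s) (sqrtNeg_mem 3))) h2
  · refine ⟨Polynomial.X ^ 2 - Polynomial.X + 1, by monicity!, ?_⟩
    simp
    linear_combination (s : ℂ) ^ 2 / 4 * hs - 3 / 4 * hs1'
  · have h1 := normSq_add_mul_sqrtNeg 3 (1 / 2) (-s / 2)
    have h2 : ((1 : ℂ) - s * sqrtNeg 3) / 2 =
        ((1 / 2 : ℝ) : ℂ) + ((-s / 2 : ℝ) : ℂ) * sqrtNeg 3 := by push_cast; ring
    have hs1'' : (s : ℝ) ^ 2 = 1 := by exact_mod_cast hs1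
    rw [h2, h1]
    push_cast
    linear_combination 3 / 4 * hs1''
  · rw [zsqrtdHom_mk]
    push_cast
    linear_combination h / 2 + ha' / 2 - (B * sqrtNeg 3 / 2) * hs1' + ((s : ℂ) ^ 2 * a / 2) * hs -
      (3 * a / 2 : ℂ) * hs1'

/-- Half-integers `(A + B√(-P)) / 2` with `A, B` odd: if their `m`-th power lies in `ℤ[√(-P)]`, then
`3 ∣ m`, and their cube lies in `ℤ[√(-P)]`. -/
theorem exists_cube_of_half_integer {P : ℕ} (hP8 : P % 8 = 3) {α : ℂ} {A B N x k : ℤ}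
    {m : ℕ} (hA : Odd A) (hB : Odd B) (hNodd : Odd N) (hN : A ^ 2 + P * B ^ 2 = 4 * N)
    (hα : 2 * α = A + B * sqrtNeg P) (hαN : Complex.normSq α = N)
    (h : zsqrtdHom P ⟨x, k⟩ = α ^ m) :
    ∃ (j : ℕ) (g : ℤ√(-(P : ℤ))), m = 3 * j ∧ g ^ j = ⟨x, k⟩ := by
  have hP0 : 0 < P := by omega
  have hPodd : Odd P := Nat.odd_iff.2 (by omega)
  have hPoddz : Odd (P : ℤ) := by exact_mod_cast hPodd
  have hs := sqrtNeg_sq P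
  push_cast at hs
  obtain ⟨a, ha⟩ : ∃ a, A * (A ^ 2 - 3 * P * B ^ 2) = 8 * a := by
    obtain ⟨n, rfl⟩ := hNodd
    obtain ⟨t, ht⟩ := (hPoddz.mul (hB.pow (n := 2)))
    exact ⟨A * (n - t), by linear_combination A * hN - 4 * A * ht⟩
  obtain ⟨b, hb⟩ : ∃ b, B * (3 * A ^ 2 - P * B ^ 2) = 8 * b := by
    obtain ⟨n, rfl⟩ := hNodd
    obtain ⟨t, ht⟩ := (hA.pow (n := 2))
    exact ⟨B * (t - n), by linear_combination -B * hN + 4 * B * ht⟩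
  have hα3 : α ^ 3 = zsqrtdHom P ⟨a, b⟩ := by
    have ha' : (A : ℂ) * (A ^ 2 - 3 * P * B ^ 2) = 8 * a := by exact_mod_cast ha
    have hb' : (B : ℂ) * (3 * A ^ 2 - P * B ^ 2) = 8 * b := by exact_mod_cast hb
    have hα' : α = (A + B * sqrtNeg P) / 2 := by rw [← hα]; ring
    rw [zsqrtdHom_mk, hα']
    linear_combination (1 / 8 : ℂ) * ha' + (1 / 8 : ℂ) * sqrtNeg P * hb' +
      (3 / 8 * A * B ^ 2 + 1 / 8 * B ^ 3 * sqrtNeg P : ℂ) * hs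
  have hnodd : Odd (⟨a, b⟩ : ℤ√(-(P : ℤ))).norm := by
    have h1 := congrArg Complex.normSq hα3
    rw [map_pow, hαN, normSq_zsqrtdHom] at h1
    have h2 : N ^ 3 = (⟨a, b⟩ : ℤ√(-(P : ℤ))).norm := by exact_mod_cast h1
    rw [← h2]; exact hNodd.pow
  -- multiplying by a half-integer with odd coordinates leaves `ℤ[√(-P)]`
  have key : ∀ (j : ℕ) (E F : ℤ) (β : ℂ), Odd E → Odd F → 2 * β = E + F * sqrtNeg P →
      zsqrtdHom P ⟨x, k⟩ ≠ (α ^ 3) ^ j * β := by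
    intro j E F β hE hF hβ hj
    rw [hα3, ← map_pow] at hj
    have hno : Odd ((⟨a, b⟩ : ℤ√(-(P : ℤ))) ^ j).norm := by
      rw [Zsqrtd.norm_pow]; exact hnodd.pow
    generalize (⟨a, b⟩ : ℤ√(-(P : ℤ))) ^ j = z at hj hno
    obtain ⟨c, d⟩ := z
    rw [norm_mk_neg] at hno
    have hcd := odd_add_of_odd_norm hPodd hno
    rw [zsqrtdHom_mk, zsqrtdHom_mk] at hj
    have h2 : ((2 * x : ℤ) : ℂ) + (2 * k : ℤ) * sqrtNeg P =
        (E * c - P * F * d : ℤ) + (E * d + F * c : ℤ) * sqrtNeg P := by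
      push_cast
      linear_combination 2 * hj + (c + d * sqrtNeg P) * hβ + F * d * hs
    have h3 := (add_mul_sqrtNeg_inj hP0 h2).1
    obtain ⟨E, rfl⟩ := hE
    obtain ⟨f, hf⟩ := hPoddz.mul hF
    have h4 : Even (c + d) := ⟨x - E * c + f * d + d, by linear_combination -h3 + d * hf⟩
    exact (Int.not_even_iff_odd.2 hcd) h4
  have hm : m % 3 < 3 := Nat.mod_lt _ (by norm_num)
  have hm3 := Nat.div_add_mod m 3
  generalize m / 3 = j at hm3
  interval_cases hr : m % 3
  · refine ⟨j, ⟨a, b⟩, by omega, zsqrtdHom_injective hP0 ?_⟩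
    rw [map_pow, ← hα3, h, ← pow_mul, ← hm3, add_zero]
  · exfalso
    refine key j A B α hA hB hα ?_
    rw [h, ← hm3, pow_add, pow_mul, pow_one]
  · exfalso
    refine key j (A ^ 2 - 2 * N) (A * B) (α ^ 2) ?_ (hA.mul hB) ?_ ?_
    · exact hA.pow.sub_even (even_two_mul N)
    · have hN' : (A : ℂ) ^ 2 + P * B ^ 2 = 4 * N := by exact_mod_cast hN
      have hα' : α = (A + B * sqrtNeg P) / 2 := by rw [← hα]; ring
      rw [hα']
      push_cast
      linear_combination -hN' / 2 + (B : ℂ) ^ 2 / 2 * hs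
    · rw [h, ← hm3, pow_add, pow_mul]

/-- Factorisation of `x² + P k² = y ^ n`: up to sign, `x + k√(-P)` is an `m`-th power in
`ℤ[√(-P)]`, where `n / m` divides `h` or, if `3 < P ≡ 3 (mod 8)`, divides `3 h`. -/
theorem exists_pow_eq_in_zsqrtd {P : ℕ} (hP : Squarefree P) {x k y : ℤ} {n h : ℕ} (hn : 0 < n)
    (hh : ∀ I : Ideal (NumberField.RingOfIntegers (imagQuadField P)), (I ^ h).IsPrincipal)
    (heq : x ^ 2 + P * k ^ 2 = y ^ n) (hcop : IsCoprime (2 * x) y) (hP1 : P = 1 → Odd x) :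
    ∃ (g : ℤ√(-(P : ℤ))) (l m : ℕ), n = l * m ∧
      l ∣ 3 ^ (if 3 < P ∧ P % 8 = 3 then 1 else 0) * h ∧ (g ^ m = ⟨x, k⟩ ∨ g ^ m = -⟨x, k⟩) := by
  have hyodd : Odd y := by
    have h2 : IsCoprime 2 y := hcop.of_mul_left_left
    rwa [Int.isCoprime_iff_gcd_eq_one, Int.gcd_comm, ← Int.isCoprime_iff_gcd_eq_one,
      Int.isCoprime_two_right] at h2
  have hy0 : y ≠ 0 := by rintro rfl; simp at hyodd
  have hodd : Odd (x ^ 2 + P * k ^ 2) := by rw [heq]; exact hyodd.pow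
  obtain ⟨α, ε, ⟨hα, hαi⟩, ⟨hε, hεi⟩, hε1, h1⟩ := exists_unit_mul_pow hP hn hh heq hcop hy0
  have hgn : n = n.gcd h * (n / n.gcd h) := (Nat.mul_div_cancel' (Nat.gcd_dvd_left n h)).symm
  have hm0 : n / n.gcd h ≠ 0 := fun h0 => by rw [h0, mul_zero] at hgn; omega
  have hgd : n.gcd h ∣ h := Nat.gcd_dvd_right n h
  generalize n / n.gcd h = m at hgn h1 hm0
  generalize n.gcd h = l at hgn hgd
  obtain ⟨A, B, N, hAB, hN, hαN⟩ := exists_int_of_isIntegral hP hα hαi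
  have hNodd : Odd N := by
    have h2 := congrArg Complex.normSq h1
    rw [← zsqrtdHom_mk, normSq_zsqrtdHom, map_mul, map_pow, hε1, one_mul, hαN, norm_mk_neg] at h2
    have h3 : x ^ 2 + P * k ^ 2 = N ^ m := by exact_mod_cast h2
    rw [h3] at hodd
    exact (Int.odd_pow' hm0).1 hodd
  by_cases hev : Even A ∧ Even B
  · obtain ⟨⟨a, rfl⟩, ⟨b, rfl⟩⟩ := hev
    have hα' : α = zsqrtdHom P ⟨a, b⟩ := by
      apply mul_left_cancel₀ (two_ne_zero (α := ℂ))
      rw [hAB, zsqrtdHom_mk]; push_cast; ring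
    rw [hα'] at h1
    obtain ⟨g, hg⟩ := exists_pow_eq_of_mem hP hodd hP1 hε hεi hε1 _ h1
    exact ⟨g, l, m, hgn, hgd.mul_left _, hg⟩
  · obtain ⟨hA, hB, hP8⟩ := odd_of_not_even hP hN hNodd hev
    by_cases hP3 : P = 3
    · subst hP3
      obtain ⟨η, g, hη, hηi, hη1, hαg⟩ := exists_unit_mul_eq_zsqrtd hA hB hAB
      rw [hαg, mul_pow, ← mul_assoc] at h1
      obtain ⟨g, hg⟩ := exists_pow_eq_of_mem hP hodd hP1 (mul_mem hε (pow_mem hη m))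
        (hεi.mul (hηi.pow m)) (by rw [map_mul, map_pow, hε1, hη1]; simp) _ h1
      exact ⟨g, l, m, hgn, hgd.mul_left _, hg⟩
    · have hε' : ε = 1 ∨ ε = -1 := by
        rcases unit_cases hP hε hεi hε1 with h2 | ⟨h2, -⟩ | ⟨h2, -⟩
        · exact h2
        · omega
        · omega
      have hx' : ∃ x' k' : ℤ, zsqrtdHom P ⟨x', k'⟩ = α ^ m ∧
          ((⟨x', k'⟩ : ℤ√(-(P : ℤ))) = ⟨x, k⟩ ∨ (⟨x', k'⟩ : ℤ√(-(P : ℤ))) = -⟨x, k⟩) := by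
        rw [← zsqrtdHom_mk] at h1
        rcases hε' with rfl | rfl
        · exact ⟨x, k, by rw [h1, one_mul], Or.inl rfl⟩
        · refine ⟨-x, -k, ?_, Or.inr rfl⟩
          have : (⟨-x, -k⟩ : ℤ√(-(P : ℤ))) = -⟨x, k⟩ := rfl
          rw [this, map_neg, h1]; ring
      obtain ⟨x', k', hx', hsgn⟩ := hx'
      obtain ⟨j, g, rfl, hg⟩ := exists_cube_of_half_integer hP8 hA hB hNodd hN hAB hαN hx'
      refine ⟨g, l * 3, j, by rw [hgn]; ring, ?_, by rwa [hg]⟩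
      rw [if_pos ⟨by omega, hP8⟩, pow_one, mul_comm 3]
      exact mul_dvd_mul_right hgd 3

/-! ### The equation `3 ^ t + 4 = z ^ j` -/

theorem mk_pow_eq_rescale_neg (P : ℕ) (c b : ℤ) (n : ℕ) :
    (⟨c, b⟩ : ℤ√(-(P : ℤ))) ^ n =
      ⟨((⟨c, 1⟩ : ℤ√(-((P * b.natAbs ^ 2 : ℕ) : ℤ))) ^ n).re,
        b * ((⟨c, 1⟩ : ℤ√(-((P * b.natAbs ^ 2 : ℕ) : ℤ))) ^ n).im⟩ := by
  have h : -((P * b.natAbs ^ 2 : ℕ) : ℤ) = -(P : ℤ) * b ^ 2 := by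
    push_cast; rw [sq_abs]; ring
  rw [h]
  exact Zsqrtd.mk_pow_eq_rescale _ c b n

theorem dvd_mk_one_pow_sub (D : ℕ) (c : ℤ) (n : ℕ) :
    (D : ℤ) ∣ ((⟨c, 1⟩ : ℤ√(-(D : ℤ))) ^ n).re - c ^ n ∧
      (D : ℤ) ∣ ((⟨c, 1⟩ : ℤ√(-(D : ℤ))) ^ (n + 1)).im - (n + 1) * c ^ n := by
  have hre : ∀ n, (D : ℤ) ∣ ((⟨c, 1⟩ : ℤ√(-(D : ℤ))) ^ n).re - c ^ n := by
    intro n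
    induction n with
    | zero => simp
    | succ n ih =>
      obtain ⟨s, hs⟩ := ih
      rw [pow_succ, Zsqrtd.re_mul]
      exact ⟨c * s - ((⟨c, 1⟩ : ℤ√(-(D : ℤ))) ^ n).im, by linear_combination c * hs⟩
  refine ⟨hre n, ?_⟩
  induction n with
  | zero => simp
  | succ n ih =>
    obtain ⟨s, hs⟩ := ih
    obtain ⟨t, ht⟩ := hre (n + 1)
    rw [pow_succ, Zsqrtd.im_mul]
    exact ⟨c * s + t, by push_cast at hs ⊢; linear_combination c * hs + ht⟩

theorem dvd_re_pow_of_odd {D : ℕ} {c : ℤ} {r : ℕ} (hr : Odd r) :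
    c ∣ ((⟨c, 1⟩ : ℤ√(-(D : ℤ))) ^ r).re := by
  obtain ⟨k, rfl⟩ := hr
  obtain ⟨s, hs⟩ := exists_re_pow_eq_mul D k c
  exact ⟨_, hs⟩

/-- The field `ℚ(√(-3))` is the third cyclotomic field. -/
theorem imagQuadField_three_isPrincipalIdealRing :
    IsPrincipalIdealRing (NumberField.RingOfIntegers (imagQuadField 3)) := by
  have hs := sqrtNeg_sq 3
  push_cast at hs
  have hζ : IsPrimitiveRoot ((-1 + sqrtNeg 3) / 2) 3 := by
    have h3 : ((-1 + sqrtNeg 3) / 2) ^ 3 = 1 := by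
      linear_combination (-3 / 8 + sqrtNeg 3 / 8) * hs
    have h1 : ((-1 + sqrtNeg 3) / 2) ≠ 1 := by
      intro h
      have h' : sqrtNeg 3 = 3 := by linear_combination 2 * h
      rw [h'] at hs
      norm_num at hs
    have h := IsPrimitiveRoot.orderOf ((-1 + sqrtNeg 3) / 2)
    rwa [orderOf_eq_prime h3 h1] at h
  have hcyc : @IsCyclotomicExtension {3} ℚ (imagQuadField 3) _ _
      (IntermediateField.algebra' _) := by
    rw [IntermediateField.isCyclotomicExtension_singleton_iff_eq_adjoin (K := ℚ) (L := ℂ) (hζ := hζ)]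
    apply le_antisymm
    · rw [IntermediateField.adjoin_le_iff, Set.singleton_subset_iff]
      change sqrtNeg 3 ∈ _
      have h1 := IntermediateField.mem_adjoin_simple_self ℚ ((-1 + sqrtNeg 3) / 2)
      have h2 : sqrtNeg 3 = 2 * ((-1 + sqrtNeg 3) / 2) + 1 := by ring
      rw [h2]
      exact add_mem (mul_mem (ofNat_mem _ 2) (by rwa [← h2])) (one_mem _)
    · rw [IntermediateField.adjoin_le_iff, Set.singleton_subset_iff]
      exact div_mem (add_mem (neg_mem (one_mem _)) (sqrtNeg_mem 3)) (ofNat_mem _ 2)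
  -- the two `ℚ`-algebra structures on the field agree
  have : IsCyclotomicExtension {3} ℚ (imagQuadField 3) := by
    convert hcyc
    exact Subsingleton.elim _ _
  exact IsCyclotomicExtension.Rat.three_pid _

/-- Factorisation in `ℤ[i]`, where all units are `j`-th powers for odd `j`. -/
theorem GaussianInt.exists_pow_eq_of_odd {s z : ℤ} {j : ℕ} (hj : Odd j) (hz : Odd z)
    (h : s ^ 2 + 4 = z ^ j) : ∃ g : ℤ√(-((1 : ℕ) : ℤ)), g ^ j = ⟨s, 2⟩ := by
  have hmul : (⟨s, 2⟩ : GaussianInt) * ⟨s, -2⟩ = (z : GaussianInt) ^ j := by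
    rw [← Int.cast_pow, ← h, Zsqrtd.intCast_val]
    ext <;> simp <;> ring
  have hcop : IsCoprime (⟨s, 2⟩ : GaussianInt) ⟨s, -2⟩ := by
    have h1 : IsCoprime (4 : ℤ) (z ^ j) := by
      have h2 : IsCoprime (2 : ℤ) z := Int.isCoprime_two_left.2 hz
      exact (h2.pow (m := 2) (n := j))
    obtain ⟨a, b, hab⟩ := h1
    have hab' : (a : GaussianInt) * 4 + b * z ^ j = 1 := by exact_mod_cast congrArg (Int.cast) hab
    refine ⟨a * ⟨0, -1⟩ + b * ⟨s, -2⟩, a * ⟨0, 1⟩, ?_⟩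
    rw [← hab', ← hmul]
    have : (⟨0, -1⟩ : GaussianInt) * ⟨s, 2⟩ + ⟨0, 1⟩ * ⟨s, -2⟩ = 4 := by ext <;> simp
    linear_combination (a : GaussianInt) * this
  obtain ⟨d, u, hu⟩ := exists_associated_pow_of_mul_eq_pow' hcop hmul
  have hu4 : (u : GaussianInt) ^ 4 = 1 := by
    have h1 : (u : GaussianInt).norm = 1 := (Zsqrtd.norm_eq_one_iff' (by norm_num) _).2 u.isUnit
    generalize (u : GaussianInt) = v at h1
    obtain ⟨a, b⟩ := v
    rw [Zsqrtd.norm_def] at h1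
    have h1 : a ^ 2 + b ^ 2 = 1 := by simp at h1; linear_combination h1
    have ha : -1 ≤ a ∧ a ≤ 1 := by constructor <;> nlinarith [sq_nonneg b]
    have hb : -1 ≤ b ∧ b ≤ 1 := by constructor <;> nlinarith [sq_nonneg a]
    obtain ⟨ha1, ha2⟩ := ha
    obtain ⟨hb1, hb2⟩ := hb
    interval_cases a <;> interval_cases b <;> first | (exfalso; revert h1; decide) | decide
  refine ⟨d * u ^ j, ?_⟩
  have huj : (u : GaussianInt) ^ (j * j) = u := by
    obtain ⟨k, rfl⟩ := hj
    rw [show (2 * k + 1) * (2 * k + 1) = 4 * (k * k + k) + 1 by ring, pow_succ, pow_mul, hu4]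
    simp
  have : (d * (u : GaussianInt) ^ j) ^ j = ⟨s, 2⟩ := by
    rw [mul_pow, ← pow_mul, huj, hu]
  exact this

/-- For `j = 2` the factors `z ± 2` of `3 ^ t` differ by `4`; for `j = 3` cubes modulo `9` suffice.
For `j ≥ 5` the left side is the norm of `3 ^ f + 2i` if `t = 2 f`, and of `2 + 3 ^ f √(-3)` if
`t = 2 f + 1`; both rings have class number one, so these are `j`-th powers up to sign. -/
theorem three_pow_add_four_ne_pow_prime {t j : ℕ} {z : ℤ} (hz : AtMostOnePrime z) (hz0 : 0 < z)
    (hj : j.Prime) : (3 : ℤ) ^ t + 4 ≠ z ^ j := by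
  intro h
  have hzodd : Odd z := by
    have h1 : Odd ((3 : ℤ) ^ t + 4) := (Odd.pow (by decide)).add_even (by decide)
    rw [h] at h1
    exact (Int.odd_pow' hj.ne_zero).1 h1
  rcases hj.eq_two_or_odd' with rfl | hjodd
  · have h1 : (z + 2) * (z - 2) = 3 ^ t := by linear_combination -h
    have hz3 : 3 ≤ z := by
      by_contra hlt
      have h3 : (0 : ℤ) < 3 ^ t := by positivity
      nlinarith
    have pow3 : ∀ w : ℤ, 0 < w → w ∣ 3 ^ t → w = 1 ∨ 3 ∣ w := by
      intro w hw hd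
      have hd' : w.natAbs ∣ 3 ^ t := by
        have := Int.natAbs_dvd_natAbs.2 hd
        rwa [Int.natAbs_pow] at this
      obtain ⟨i, -, hi⟩ := (Nat.dvd_prime_pow Nat.prime_three).1 hd'
      rcases Nat.eq_zero_or_pos i with rfl | hi0
      · left; simp at hi; omega
      · right
        rw [← Int.natAbs_of_nonneg hw.le, hi]
        exact_mod_cast dvd_pow_self 3 hi0.ne'
    have h2 := pow3 (z + 2) (by omega) ⟨_, h1.symm⟩
    have h3 := pow3 (z - 2) (by omega) ⟨z + 2, by rw [← h1]; ring⟩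
    omega
  by_cases hj3 : j = 3
  · subst hj3
    have hcube : z ^ 3 % 9 = 0 ∨ z ^ 3 % 9 = 1 ∨ z ^ 3 % 9 = 8 := by
      have : z % 9 = 0 ∨ z % 9 = 1 ∨ z % 9 = 2 ∨ z % 9 = 3 ∨ z % 9 = 4 ∨ z % 9 = 5 ∨ z % 9 = 6 ∨
        z % 9 = 7 ∨ z % 9 = 8 := by omega
      rcases this with h | h | h | h | h | h | h | h | h <;>
        simp [pow_succ, Int.mul_emod, h]
    rcases t with _ | _ | t
    · norm_num at h; omega
    · norm_num at h; omega
    · have : (3 : ℤ) ^ (t + 1 + 1) = 9 * 3 ^ t := by ring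
      omega
  have hj5 : 5 ≤ j := by
    have h1 := hj.two_le
    have h2 : j ≠ 4 := by rintro rfl; revert hjodd; decide
    have h3 : j ≠ 2 := by rintro rfl; revert hjodd; decide
    omega
  rcases Nat.even_or_odd' t with ⟨f, rfl | rfl⟩
  · obtain ⟨⟨c, b⟩, hg⟩ := GaussianInt.exists_pow_eq_of_odd (s := 3 ^ f) hjodd hzodd (by
      rw [← h]; ring)
    have hnorm := congrArg Zsqrtd.norm hg
    rw [Zsqrtd.norm_pow, norm_mk_neg, norm_mk_neg] at hnorm
    have hzn : c ^ 2 + b ^ 2 = z := by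
      have h1 : (c ^ 2 + b ^ 2) ^ j = z ^ j := by
        rw [← h]; push_cast at hnorm; rw [one_mul] at hnorm; rw [hnorm]; ring
      exact (pow_left_inj₀ (by positivity) hz0.le hj.ne_zero).1 h1
    rw [mk_pow_eq_rescale_neg] at hg
    have hV := congrArg Zsqrtd.re hg
    have hU := congrArg Zsqrtd.im hg
    simp only [] at hV hU
    rw [one_mul] at hV hU
    have hc : c ∣ 3 ^ f := by rw [← hV]; exact dvd_re_pow_of_odd hjodd
    have hcodd : Odd c := by
      have : Odd ((3 : ℤ) ^ f) := Odd.pow (by decide)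
      obtain ⟨e, he⟩ := hc
      rw [he, Int.odd_mul] at this
      exact this.1
    have hb : Even b := by
      rw [← hzn] at hzodd
      simp [Int.odd_add, Int.odd_pow, Int.even_pow, hcodd] at hzodd
      exact hzodd
    have hb2 : b ∣ 2 := ⟨_, hU.symm⟩
    have hb0 : b ≠ 0 := by rintro rfl; norm_num at hb2
    have hU1 : IsUnit ((⟨c, 1⟩ : ℤ√(-((b.natAbs ^ 2 : ℕ) : ℤ))) ^ j).im := by
      obtain ⟨b', rfl⟩ := hb
      exact IsUnit.of_mul_eq_one b' (by linarith)
    -- the imaginary part of the power is a unit, and `b² = 10` has no solution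
    have hcore := eq_ten_of_prime_exponent (D := b.natAbs ^ 2) (c := c) hj hj5
      ((Int.natAbs_even.2 hb).pow_of_ne_zero two_ne_zero) (by positivity) ?_ ?_ ?_ hU1.ne_zero ?_
    · obtain ⟨-, h10, -⟩ := hcore
      have h4 : b.natAbs < 4 := by nlinarith
      interval_cases b.natAbs <;> omega
    · push_cast
      rw [sq_abs]
      have h1 : IsCoprime ((3 : ℤ) ^ f) 2 := IsCoprime.pow_left (by norm_num)
      exact (h1.of_isCoprime_of_dvd_left hc |>.of_isCoprime_of_dvd_right hb2).pow_right
    · rw [hV]; exact atMostOnePrime_prime_pow Nat.prime_three f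
    · push_cast; rw [sq_abs, hzn]; exact hz
    · intro q hq hqU
      exact absurd (isUnit_of_dvd_unit hqU hU1) (Nat.prime_iff_prime_int.1 hq).not_isUnit
  · have hpid := imagQuadField_three_isPrincipalIdealRing
    have hcop : IsCoprime ((2 : ℤ) * 2) z := by
      have h2 : IsCoprime (2 : ℤ) z := Int.isCoprime_two_left.2 hzodd
      exact h2.mul_left h2
    obtain ⟨⟨c, b⟩, l, m, hlm, hl, hg⟩ := exists_pow_eq_in_zsqrtd (P := 3) (x := 2) (k := 3 ^ f)
      (y := z) (n := j) (h := 1) Nat.prime_three.squarefree hj.pos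
      (fun I => IsPrincipalIdealRing.principal _) (by rw [← h]; push_cast; ring) hcop (by norm_num)
    simp at hl
    subst hl
    rw [one_mul] at hlm
    subst hlm
    have hnorm : ((⟨c, b⟩ : ℤ√(-((3 : ℕ) : ℤ))) ^ j).norm = 2 ^ 2 + 3 * (3 ^ f) ^ 2 := by
      rcases hg with hg | hg <;> rw [hg] <;> [skip; rw [Zsqrtd.norm_neg]] <;> rw [norm_mk_neg] <;>
        norm_num
    rw [Zsqrtd.norm_pow, norm_mk_neg] at hnorm
    have hzn : c ^ 2 + 3 * b ^ 2 = z := by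
      have h1 : (c ^ 2 + 3 * b ^ 2) ^ j = z ^ j := by
        rw [← h]; push_cast at hnorm; rw [hnorm]; ring
      exact (pow_left_inj₀ (by positivity) hz0.le hj.ne_zero).1 h1
    rw [mk_pow_eq_rescale_neg] at hg
    obtain ⟨-, hD⟩ := dvd_mk_one_pow_sub (3 * b.natAbs ^ 2) c (j - 1)
    rw [Nat.sub_add_cancel hj.one_le] at hD
    have hc : c ∣ ((⟨c, 1⟩ : ℤ√(-((3 * b.natAbs ^ 2 : ℕ) : ℤ))) ^ j).re :=
      dvd_re_pow_of_odd hjodd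
    generalize (⟨c, 1⟩ : ℤ√(-((3 * b.natAbs ^ 2 : ℕ) : ℤ))) ^ j = w at hg hD hc
    have hV : w.re ∣ 2 := by
      rcases hg with hg | hg
      · have := congrArg Zsqrtd.re hg
        simp only [] at this
        rw [this]
      · have := congrArg Zsqrtd.re hg
        simp only [Zsqrtd.re_neg] at this
        rw [this, Int.neg_dvd]
    have hU : b * w.im = 3 ^ f ∨ b * w.im = -3 ^ f := by
      rcases hg with hg | hg
      · exact Or.inl (congrArg Zsqrtd.im hg)
      · exact Or.inr (congrArg Zsqrtd.im hg)
    have hc2 := hc.trans hV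
    have hbodd : Odd b := by
      have h1 : Odd (b * w.im) := by
        have h2 : Odd ((3 : ℤ) ^ f) := Odd.pow (by decide)
        rcases hU with hU | hU <;> rw [hU]
        · exact h2
        · exact h2.neg
      exact (Int.odd_mul.1 h1).1
    have hceven : Even c := by
      have h1 : Odd (3 * b ^ 2) := Odd.mul (by decide) hbodd.pow
      rw [← hzn, Int.odd_add'] at hzodd
      have := hzodd.1 h1
      exact (Int.even_pow.1 this).1
    have hc3 : ¬ (3 : ℤ) ∣ c := by
      intro h3
      have := h3.trans hc2
      norm_num at this
    have hc4 : c ^ 2 = 4 := by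
      have h1 := Int.natAbs_dvd_natAbs.2 hc2
      have h2 : c.natAbs = 2 := by
        rcases (Nat.dvd_prime Nat.prime_two).1 h1 with h2 | h2
        · exfalso
          have := Int.natAbs_even.2 hceven
          rw [h2] at this
          revert this; decide
        · exact h2
      rw [← Int.natAbs_sq, h2]; norm_num
    -- modulo `3` the imaginary part is `j * c ^ (j - 1)`, which is prime to `3`, so it is `±1`;
    -- then `z ^ j = 4 + 3 b² = z`
    by_cases h3U : (3 : ℤ) ∣ w.im
    · have h1 : (3 : ℤ) ∣ w.im - ((j - 1 : ℕ) + 1) * c ^ (j - 1) :=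
        dvd_trans ⟨(b.natAbs : ℤ) ^ 2, by push_cast; ring⟩ hD
      have h2 : (3 : ℤ) ∣ ((j - 1 : ℕ) + 1) * c ^ (j - 1) := (dvd_sub_right h3U).1 h1
      have h3 : ((j - 1 : ℕ) + 1 : ℤ) = j := by have := hj.one_le; omega
      rw [h3] at h2
      rcases Int.prime_three.dvd_or_dvd h2 with h4 | h4
      · have := (Nat.prime_dvd_prime_iff_eq Nat.prime_three hj).1 (by exact_mod_cast h4)
        exact hj3 this.symm
      · exact hc3 (Int.prime_three.dvd_of_dvd_pow h4)
    · have h1 : w.im.natAbs ∣ 3 ^ f := by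
        have h2 : w.im ∣ 3 ^ f := by
          rcases hU with hU | hU
          · exact ⟨b, by rw [← hU]; ring⟩
          · exact ⟨-b, by linear_combination hU⟩
        have := Int.natAbs_dvd_natAbs.2 h2
        rwa [Int.natAbs_pow] at this
      obtain ⟨i, -, hi⟩ := (Nat.dvd_prime_pow Nat.prime_three).1 h1
      rcases Nat.eq_zero_or_pos i with rfl | hi0
      · have h2 : w.im ^ 2 = 1 := by rw [← Int.natAbs_sq, hi]; norm_num
        have h3 : b ^ 2 = (3 ^ f) ^ 2 := by
          rcases hU with hU | hU
          · rw [← hU]; linear_combination -b ^ 2 * h2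
          · rw [← neg_sq (3 ^ f), ← hU]; linear_combination -b ^ 2 * h2
        have h4 : z ^ j = z := by
          rw [← h, ← hzn, hc4, h3]; ring
        have h5 : (1 : ℤ) < z := by nlinarith [sq_nonneg b]
        have h6 := pow_lt_pow_right₀ h5 hj.one_lt
        rw [pow_one, h4] at h6
        exact lt_irrefl _ h6
      · apply h3U
        rw [← Int.natAbs_dvd_natAbs, hi]
        exact dvd_pow_self 3 hi0.ne'

/-- `3 ^ t + 4` is not a proper power of a prime power. -/
theorem three_pow_add_four_ne_pow {t j : ℕ} {z : ℤ} (hz : AtMostOnePrime z) (hz0 : 0 < z)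
    (hj : j ≠ 1) (h : (3 : ℤ) ^ t + 4 = z ^ j) : False := by
  obtain ⟨i, hi⟩ := Nat.minFac_dvd j
  rw [hi, mul_comm, pow_mul] at h
  exact three_pow_add_four_ne_pow_prime (hz.pow i) (by positivity) (Nat.minFac_prime hj) h

/-! ### Primitive prime divisors and the least common multiple -/

theorem dvd_of_dvd_prime_pow_mul {a r e t : ℕ} (hr : r.Prime) (h : a ∣ r ^ (e + 1) * t)
    (hra : ¬ r ^ (e + 1) ∣ a) : a ∣ r ^ e * t := by
  obtain ⟨a1, a2, h1, h2, rfl⟩ := (Nat.dvd_mul).1 h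
  obtain ⟨f, hf, rfl⟩ := (Nat.dvd_prime_pow hr).1 h1
  have : f ≠ e + 1 := by rintro rfl; exact hra (Dvd.intro _ rfl)
  exact mul_dvd_mul (pow_dvd_pow r (by omega)) h2

/-- The rank of apparition of `q` in the sequence `im (g ^ j)` divides `q - (-P/q)`; if it divides
`r ^ (e + 1) * t` but not `r ^ e * t`, it is a multiple of `r ^ (e + 1)`. -/
theorem prime_pow_dvd_symbolLcm {P Q : ℕ} (g : ℤ√(-(P : ℤ))) {q r e t : ℕ}
    (hq : q ∈ Q.primeFactors) (hr : r.Prime) (hqP : ¬ q ∣ P) (hqn : ¬ (q : ℤ) ∣ g.norm)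
    (h1 : (q : ℤ) ∣ (g ^ (r ^ (e + 1) * t)).im) (h2 : ¬ (q : ℤ) ∣ (g ^ (r ^ e * t)).im) :
    ((r ^ (e + 1) : ℕ) : ℤ) ∣ symbolLcm P Q := by
  have hqp := Nat.prime_of_mem_primeFactors hq
  have hqz := Nat.prime_iff_prime_int.1 hqp
  have hfact := Fact.mk hqp
  have hd : ¬ (q : ℤ) ∣ -(P : ℤ) := by
    rw [Int.dvd_neg, Int.natCast_dvd_natCast]; exact hqP
  obtain ⟨M, hM, hMim⟩ : ∃ M : ℕ, (M : ℤ) = q - legendreOrZero (-(P : ℤ)) q ∧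
      (q : ℤ) ∣ (g ^ M).im := by
    -- the symbol vanishes at `2`, and the imaginary part of a square is even
    by_cases hq2 : q = 2
    · subst hq2
      refine ⟨2, by simp [legendreOrZero], ?_⟩
      rw [sq, Zsqrtd.im_mul]
      exact ⟨g.re * g.im, by push_cast; ring⟩
    · have hleg : legendreOrZero (-(P : ℤ)) q = legendreSym q (-(P : ℤ)) := by
        simp [legendreOrZero, hqp, hq2]
      have hle : legendreSym q (-(P : ℤ)) ≤ 1 := by
        have hne : ((-(P : ℤ) : ℤ) : ZMod q) ≠ 0 := by
          rwa [Ne, ZMod.intCast_zmod_eq_zero_iff_dvd]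
        rcases legendreSym.eq_one_or_neg_one q hne with h | h <;> rw [h]
        norm_num
      have hM : (((q - legendreSym q (-(P : ℤ))).toNat : ℕ) : ℤ) =
          q - legendreSym q (-(P : ℤ)) := by
        have := hqp.one_le
        omega
      exact ⟨_, by rw [hleg]; exact hM, Zsqrtd.dvd_im_pow_legendre g hq2 hqn hd hM⟩
  have hgcd := Zsqrtd.dvd_im_pow_gcd g hqz hqn _ _ h1 hMim
  have hML : (M : ℤ) ∣ symbolLcm P Q := by
    rw [hM, symbolLcm]
    exact Finset.dvd_lcm (f := fun q : ℕ => (q : ℤ) - legendreOrZero (-(P : ℤ)) q) hq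
  by_cases hrM : r ^ (e + 1) ∣ M
  · exact (Int.natCast_dvd_natCast.2 hrM).trans hML
  · exfalso
    have h3 : (r ^ (e + 1) * t).gcd M ∣ r ^ e * t :=
      dvd_of_dvd_prime_pow_mul hr (Nat.gcd_dvd_left _ _)
        fun h => hrM (h.trans (Nat.gcd_dvd_right _ _))
    obtain ⟨s, hs⟩ := h3
    apply h2
    rw [hs]
    exact Zsqrtd.dvd_im_pow_mul g _ _ hgcd

/-- If `r ^ (e + 1)` does not divide the least common multiple, then in the step from
`g ^ (r ^ e * t) = c + √(-D)` to its `r`-th power the imaginary part acquires no prime factor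
other than `r`. -/
theorem no_primitive_prime {P Q : ℕ} {k : ℤ} (g : ℤ√(-(P : ℤ)))
    (hQ : ∀ q : ℕ, q.Prime → (q : ℤ) ∣ k → ¬ q ∣ P → q ∈ Q.primeFactors)
    (hn : ∀ q : ℕ, q.Prime → q ∣ P ∨ (q : ℤ) ∣ k → ¬ (q : ℤ) ∣ g.norm)
    {r e t : ℕ} (hr : r.Prime) (hk : (g ^ (r ^ (e + 1) * t)).im ∣ k)
    (hL : ¬ ((r ^ (e + 1) : ℕ) : ℤ) ∣ symbolLcm P Q) {c : ℤ} {D : ℕ}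
    (hc : c = (g ^ (r ^ e * t)).re) (hD : D = P * (g ^ (r ^ e * t)).im.natAbs ^ 2) :
    c ^ 2 + D = g.norm ^ (r ^ e * t) ∧ IsCoprime c D ∧
      (g ^ (r ^ (e + 1) * t)).re = ((⟨c, 1⟩ : ℤ√(-(D : ℤ))) ^ r).re ∧
      (g ^ (r ^ (e + 1) * t)).im =
        (g ^ (r ^ e * t)).im * ((⟨c, 1⟩ : ℤ√(-(D : ℤ))) ^ r).im ∧
      ∀ q : ℕ, q.Prime → (q : ℤ) ∣ ((⟨c, 1⟩ : ℤ√(-(D : ℤ))) ^ r).im → q = r := by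
  have hpow : g ^ (r ^ (e + 1) * t) = (g ^ (r ^ e * t)) ^ r := by
    rw [← pow_mul]; congr 1; ring
  have hnorm := Zsqrtd.norm_pow g (r ^ e * t)
  have hgz : g ^ (r ^ e * t) = ⟨c, (g ^ (r ^ e * t)).im⟩ := by rw [hc]
  set d := (g ^ (r ^ e * t)).im with hd
  have hDz : (D : ℤ) = P * d ^ 2 := by rw [hD]; push_cast; rw [sq_abs]
  rw [hgz, norm_mk_neg, ← hDz] at hnorm
  have hpow' : g ^ (r ^ (e + 1) * t) = ⟨((⟨c, 1⟩ : ℤ√(-(D : ℤ))) ^ r).re,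
      d * ((⟨c, 1⟩ : ℤ√(-(D : ℤ))) ^ r).im⟩ := by
    rw [hpow, hgz, mk_pow_eq_rescale_neg, ← hD]
  rw [hpow'] at hk ⊢
  have hdk : d ∣ k := (dvd_mul_right _ _).trans hk
  have hnD : ∀ q : ℕ, q.Prime → (q : ℤ) ∣ D → ¬ (q : ℤ) ∣ c := by
    intro q hq hqD hqc
    have hqz := Nat.prime_iff_prime_int.1 hq
    refine hn q hq ?_ (hqz.dvd_of_dvd_pow (n := r ^ e * t) ?_)
    · rw [hDz] at hqD
      rcases hqz.dvd_or_dvd hqD with h | h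
      · exact Or.inl (Int.natCast_dvd_natCast.1 h)
      · exact Or.inr ((hqz.dvd_of_dvd_pow h).trans hdk)
    · rw [← hnorm]
      exact dvd_add (dvd_pow hqc two_ne_zero) hqD
  refine ⟨hnorm, ?_, rfl, rfl, ?_⟩
  · rw [Int.isCoprime_iff_gcd_eq_one]
    by_contra hne
    have hp := Nat.minFac_prime hne
    have h1 : (((Int.gcd c D).minFac : ℕ) : ℤ) ∣ (Int.gcd c D : ℕ) :=
      Int.natCast_dvd_natCast.2 (Nat.minFac_dvd _)
    exact hnD _ hp (h1.trans (Int.gcd_dvd_right _ _)) (h1.trans (Int.gcd_dvd_left _ _))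
  · intro q hq hqU
    by_contra hqr
    -- a prime dividing both `D` and the imaginary part `≡ r * c ^ (r - 1)` is `r`
    have hqz := Nat.prime_iff_prime_int.1 hq
    have hqk : (q : ℤ) ∣ k := (hqU.mul_left _).trans hk
    have hqD : ¬ (q : ℤ) ∣ D := by
      intro hqD
      have h1 := (dvd_mk_one_pow_sub D c (r - 1)).2
      rw [Nat.sub_add_cancel hr.one_le] at h1
      have h2 := (dvd_sub_right hqU).1 (hqD.trans h1)
      have h3 : ((r - 1 : ℕ) + 1 : ℤ) = r := by have := hr.one_le; omega
      rw [h3] at h2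
      rcases hqz.dvd_or_dvd h2 with h | h
      · exact hqr ((Nat.prime_dvd_prime_iff_eq hq hr).1 (Int.natCast_dvd_natCast.1 h))
      · exact hnD q hq hqD (hqz.dvd_of_dvd_pow h)
    have hqP : ¬ q ∣ P := fun h =>
      hqD (by rw [hDz]; exact (Int.natCast_dvd_natCast.2 h).mul_right _)
    have hqd : ¬ (q : ℤ) ∣ d := fun h =>
      hqD (by rw [hDz]; exact (dvd_pow h two_ne_zero).mul_left _)
    refine hL (prime_pow_dvd_symbolLcm g (hQ q hq hqk hqP) hr hqP (hn q hq (Or.inr hqk)) ?_ hqd)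
    rw [hpow']
    exact hqU.mul_left _

/-! ### The exponents `2` and `3` -/

/-- The case `r = 3`, where `(c + √(-D)) ^ 3 = c (c² - 3 D) + (3 c² - D) √(-D)`. If `c = ±1`, then
`3 - D = ±3 ^ t` and the conclusion follows. If a prime `p` divides `c`, then `c² - 3 D` is up to
sign a power of `p`, hence `±1`, or possibly `±3` for `p = 3`; both are impossible. -/
theorem norm_eq_of_exponent_three {D : ℕ} {c : ℤ} (hD0 : 0 < D) (hcop : IsCoprime c D)
    (hx : AtMostOnePrime ((⟨c, 1⟩ : ℤ√(-(D : ℤ))) ^ 3).re) (hc2 : Odd c)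
    (hU0 : ((⟨c, 1⟩ : ℤ√(-(D : ℤ))) ^ 3).im ≠ 0)
    (hU : ∀ q : ℕ, q.Prime → (q : ℤ) ∣ ((⟨c, 1⟩ : ℤ√(-(D : ℤ))) ^ 3).im → q = 3) :
    c ^ 2 + D = 3 ∨ ∃ t : ℕ, c ^ 2 + D = 3 ^ t + 4 := by
  have h3 : (⟨c, 1⟩ : ℤ√(-(D : ℤ))) ^ 3 = ⟨c * (c ^ 2 - 3 * D), 3 * c ^ 2 - D⟩ := by
    rw [pow_succ, sq]; ext <;> simp <;> ring
  rw [h3] at hx hU0 hU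
  simp only [] at hx hU0 hU
  have hpow := Nat.eq_prime_pow_of_unique_prime_dvd (p := 3) (Int.natAbs_ne_zero.2 hU0)
    (fun {d} hd hdz => hU d hd (Int.natCast_dvd.2 hdz))
  generalize (3 * c ^ 2 - (D : ℤ)).natAbs.primeFactorsList.length = t at hpow
  by_cases hc1 : c.natAbs = 1
  · have hcc : c ^ 2 = 1 := by rw [← Int.natAbs_sq, hc1]; norm_num
    rw [hcc] at hpow ⊢
    have h4 : (0 : ℤ) < 3 ^ t := by positivity
    have h5 : 3 * 1 - (D : ℤ) = 3 ^ t ∨ 3 * 1 - (D : ℤ) = -3 ^ t := by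
      rcases Int.natAbs_eq (3 * 1 - (D : ℤ)) with h | h
      · left; rw [h, hpow]; push_cast; rfl
      · right; rw [h, hpow]; push_cast; rfl
    rcases h5 with h5 | h5
    · left
      rcases Nat.eq_zero_or_pos t with rfl | ht
      · omega
      · exfalso
        have : (3 : ℤ) ∣ 3 ^ t := dvd_pow_self 3 ht.ne'
        omega
    · right; exact ⟨t, by omega⟩
  · exfalso
    have hp := Nat.minFac_prime hc1
    have hpc : (c.natAbs.minFac : ℤ) ∣ c := Int.natCast_dvd.2 (Nat.minFac_dvd _)
    generalize c.natAbs.minFac = p at hp hpc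
    have hpz := Nat.prime_iff_prime_int.1 hp
    have honly : ∀ q : ℕ, q.Prime → (q : ℤ) ∣ c * (c ^ 2 - 3 * D) → q = p := fun q hq h =>
      hx.2 q p hq hp h (hpc.mul_right _)
    have hpD : ¬ (p : ℤ) ∣ D := fun h => hpz.not_isUnit (hcop.isUnit_of_dvd' hpc h)
    have hWpow := Nat.eq_prime_pow_of_unique_prime_dvd (p := p)
      (Int.natAbs_ne_zero.2 (right_ne_zero_of_mul hx.1))
      (fun {d} hd hdz => honly d hd ((Int.natCast_dvd.2 hdz).mul_left _))
    generalize (c ^ 2 - 3 * (D : ℤ)).natAbs.primeFactorsList.length = i at hWpow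
    by_cases hp3 : p = 3
    -- here `c = 3 b`, `27 b² - D = ±1` and `9 b² - 3 D` is `±1` or `±3`
    · subst hp3
      have ht : t = 0 := by
        by_contra ht
        have h4 : (3 : ℤ) ∣ 3 * c ^ 2 - D := by
          rw [← Int.dvd_natAbs, hpow]; exact_mod_cast dvd_pow_self 3 ht
        exact hpD ((dvd_sub_right (dvd_mul_right 3 _)).1 h4)
      subst ht
      obtain ⟨b, rfl⟩ := hpc
      have hb : b ≠ 0 := by rintro rfl; simp at hx; exact hx.1 rfl
      have hb2 : 0 < b ^ 2 := by positivity
      have hi : i < 2 := by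
        by_contra hi
        have h9 : (9 : ℤ) ∣ (3 * b) ^ 2 - 3 * D := by
          rw [← Int.dvd_natAbs]
          push_cast at hWpow
          rw [hWpow]
          exact_mod_cast (pow_dvd_pow 3 (show 2 ≤ i by omega))
        apply hpD
        push_cast
        have : (3 * b) ^ 2 = 9 * b ^ 2 := by ring
        omega
      push_cast at hpow hWpow
      have e1 : (3 * b) ^ 2 = 9 * b ^ 2 := by ring
      rw [e1] at hpow hWpow
      generalize b ^ 2 = B at *
      interval_cases i <;> omega
    · have hi : i = 0 := by
        by_contra hi
        have h4 : (p : ℤ) ∣ c ^ 2 - 3 * D := by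
          rw [← Int.dvd_natAbs, hWpow]; exact_mod_cast dvd_pow_self p hi
        have h5 := (dvd_sub_right (dvd_pow hpc two_ne_zero)).1 h4
        rcases hpz.dvd_or_dvd h5 with h | h
        · exact hp3 ((Nat.prime_dvd_prime_iff_eq hp Nat.prime_three).1 (by exact_mod_cast h))
        · exact hpD h
      rw [hi, pow_zero] at hWpow
      have h3c : ¬ (3 : ℤ) ∣ c := fun h =>
        hp3 (honly 3 Nat.prime_three (by exact_mod_cast h.mul_right _)).symm
      have hcm : c ^ 2 % 3 = 1 := by
        have : c % 3 = 1 ∨ c % 3 = 2 := by omega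
        rcases this with h | h <;> simp [sq, Int.mul_emod, h]
      have hcD : c ^ 2 = 3 * D + 1 := by omega
      -- `8 D + 3 = 3 ^ t` and `c² = 3 D + 1` combine to `(3 ^ (s + 1))² = 8 c² + 1`
      have hUt : (8 * (D : ℤ) + 3) = 3 ^ t := by
        have h4 : (3 * c ^ 2 - (D : ℤ)).natAbs = 8 * D + 3 := by omega
        rw [h4] at hpow
        exact_mod_cast hpow
      have ht : Odd t := by
        rcases Nat.even_or_odd' t with ⟨s, rfl | rfl⟩
        · exfalso
          have h9 : (3 : ℤ) ^ (2 * s) % 8 = 1 := by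
            rw [pow_mul, Int.emod_emod_of_dvd _ (dvd_refl 8) |>.symm]
            have : ((3 : ℤ) ^ 2) ^ s ≡ 1 ^ s [ZMOD 8] := Int.ModEq.pow s (by decide)
            rw [one_pow] at this
            simpa [Int.ModEq] using this
          omega
        · exact ⟨s, rfl⟩
      obtain ⟨s, rfl⟩ := ht
      obtain ⟨h, hh⟩ : ∃ h : ℤ, (3 : ℤ) ^ (s + 1) = 2 * h + 1 := by
        have : Odd ((3 : ℤ) ^ (s + 1)) := Odd.pow (by decide)
        exact this
      have hprod : h * (h + 1) = 2 * c ^ 2 := by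
        have h4 : ((3 : ℤ) ^ (s + 1)) ^ 2 = 3 * 3 ^ (2 * s + 1) := by ring
        rw [hh, ← hUt] at h4
        have h5 : 4 * (h * (h + 1)) = 4 * (2 * c ^ 2) := by linear_combination h4 - 8 * hcD
        exact mul_left_cancel₀ (by norm_num) h5
      have hpos : 0 < h := by
        have : (3 : ℤ) ^ (s + 1) ≥ 3 := by
          have : (1 : ℤ) ≤ 3 ^ s := one_le_pow₀ (by norm_num)
          rw [pow_succ]; omega
        omega
      have hcc : c ^ 2 ≠ 1 := by
        intro h
        apply hc1
        rcases mul_self_eq_one_iff.1 ((sq c).symm.trans h) <;> omega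
      -- of the consecutive numbers `h`, `h + 1` one is prime to `p`, the only prime divisor of `c`
      have hcopc : ∀ w : ℤ, ¬ (p : ℤ) ∣ w → w ∣ 2 * c ^ 2 → w ∣ 2 := by
        intro w hw hd
        refine IsCoprime.dvd_of_dvd_mul_right ?_ hd
        apply IsCoprime.pow_right
        rw [Int.isCoprime_iff_gcd_eq_one]
        by_contra hne
        have hq := Nat.minFac_prime hne
        have h1 : (((Int.gcd w c).minFac : ℕ) : ℤ) ∣ (Int.gcd w c : ℕ) :=
          Int.natCast_dvd_natCast.2 (Nat.minFac_dvd _)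
        have h2 := honly _ hq ((h1.trans (Int.gcd_dvd_right _ _)).mul_right _)
        rw [h2] at h1
        exact hw (h1.trans (Int.gcd_dvd_left _ _))
      have hh2 : h ≤ 2 := by
        by_cases hph : (p : ℤ) ∣ h
        · have h1 : ¬ (p : ℤ) ∣ h + 1 := fun h2 =>
            hpz.not_isUnit (isUnit_of_dvd_one ((dvd_add_right hph).1 h2))
          have := Int.le_of_dvd (by norm_num) (hcopc (h + 1) h1 ⟨h, by rw [← hprod]; ring⟩)
          omega
        · exact Int.le_of_dvd (by norm_num) (hcopc h hph ⟨h + 1, hprod.symm⟩)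
      interval_cases h
      · omega
      · have : c ^ 2 = 3 := by omega
        omega

theorem odd_re_of_odd_norm_sq {P : ℕ} (w : ℤ√(-(P : ℤ))) (hw : Odd w.norm) : Odd (w ^ 2).re := by
  obtain ⟨a, b⟩ := w
  rw [norm_mk_neg] at hw
  obtain ⟨s, hs⟩ := hw
  rw [sq, Zsqrtd.re_mul]
  exact ⟨s - P * b ^ 2, by simp only []; linear_combination hs⟩

/-- The case `r = 2`: two consecutive squarings without primitive prime factors lead to
`(±1 ± √(-2)) ^ 4 = -7 ± 4√(-2)`. The factor `2` in `2 * symbolLcm P Q` makes both squarings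
available. -/
theorem natAbs_eq_seven_of_exponent_two {P Q : ℕ} {x k : ℤ} (g : ℤ√(-(P : ℤ)))
    (hQ : ∀ q : ℕ, q.Prime → (q : ℤ) ∣ k → ¬ q ∣ P → q ∈ Q.primeFactors)
    (hn : ∀ q : ℕ, q.Prime → q ∣ P ∨ (q : ℤ) ∣ k → ¬ (q : ℤ) ∣ g.norm)
    (hP0 : P ≠ 0) (hk0 : k ≠ 0) (hodd : Odd g.norm) {e t : ℕ} (hg : g ^ (2 ^ (e + 1) * t) = ⟨x, k⟩)
    (hL : ¬ ((2 ^ (e + 1) : ℕ) : ℤ) ∣ 2 * symbolLcm P Q) :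
    x.natAbs = 7 ∧ ∃ j, 2 ^ (e + 1) * t = 4 * j ∧ g.norm ^ j = 3 := by
  have hL' : ¬ ((2 ^ e : ℕ) : ℤ) ∣ symbolLcm P Q := fun h => hL (by
    rw [pow_succ, mul_comm (2 ^ e)]; push_cast at h ⊢; exact mul_dvd_mul_left 2 h)
  obtain ⟨f, rfl⟩ : ∃ f, e = f + 1 := by
    rcases e with _ | f
    · simp at hL'
    · exact ⟨f, rfl⟩
  -- the imaginary part of `(c + √(-D)) ^ 2` is `2 c`, so `c = ±1` if `c` is odd
  have hone : ∀ c : ℤ, Odd c → (∀ q : ℕ, q.Prime → (q : ℤ) ∣ c → q = 2) → c.natAbs = 1 := by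
    intro c hc h
    by_contra h1
    have h2 := h _ (Nat.minFac_prime h1) (Int.natCast_dvd.2 (Nat.minFac_dvd _))
    have h3 : (2 : ℤ) ∣ c := by
      have := Int.natCast_dvd.2 (Nat.minFac_dvd c.natAbs)
      rw [h2] at this
      exact this
    exact (Int.not_even_iff_odd.2 hc) (even_iff_two_dvd.2 h3)
  have him : ∀ (D : ℕ) (c : ℤ), (⟨c, 1⟩ : ℤ√(-(D : ℤ))) ^ 2 = ⟨c ^ 2 - D, 2 * c⟩ := by
    intro D c; rw [sq]; ext <;> simp <;> ring
  have hk1 : (g ^ (2 ^ (f + 1 + 1) * t)).im = k := by rw [hg]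
  have hLf : ¬ ((2 ^ (f + 1 + 1) : ℕ) : ℤ) ∣ symbolLcm P Q := fun h => hL (h.mul_left _)
  obtain ⟨-, -, hre2, him2, hU2⟩ := no_primitive_prime g hQ hn Nat.prime_two hk1.dvd hLf rfl rfl
  rw [him] at hre2 him2 hU2
  simp only [] at hre2 him2 hU2
  have hdk : (g ^ (2 ^ (f + 1) * t)).im ∣ k := by rw [← hk1, him2]; exact dvd_mul_right _ _
  obtain ⟨hN1, -, hre1, him1, hU1⟩ := no_primitive_prime g hQ hn Nat.prime_two hdk hL' rfl rfl
  rw [him] at hre1 him1 hU1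
  simp only [] at hre1 him1 hU1
  have hc2odd : Odd (g ^ (2 ^ (f + 1) * t)).re := by
    have := odd_re_of_odd_norm_sq (g ^ (2 ^ f * t)) (by rw [Zsqrtd.norm_pow]; exact hodd.pow)
    rwa [← pow_mul, show 2 ^ f * t * 2 = 2 ^ (f + 1) * t by ring] at this
  have hc2 := hone _ hc2odd fun q hq h => hU2 q hq (h.mul_left _)
  have hN1odd : Odd (g.norm ^ (2 ^ f * t)) := hodd.pow
  have hc1odd : Odd (g ^ (2 ^ f * t)).re := by
    rcases f with _ | f
    · by_contra hc1
      rw [Int.not_odd_iff_even] at hc1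
      -- here `P` is odd, so that `2` divides `Q` and hence the least common multiple
      apply hL'
      have h2k : ((2 : ℕ) : ℤ) ∣ k := by
        rw [← hk1, him2]; exact (dvd_mul_right _ _).mul_left _
      have hP2 : ¬ 2 ∣ P := by
        intro h2P
        rw [← hN1] at hN1odd
        have : Even ((P * (g ^ (2 ^ 0 * t)).im.natAbs ^ 2 : ℕ) : ℤ) := by
          rw [Int.even_coe_nat]; exact (even_iff_two_dvd.2 h2P).mul_right _
        exact (Int.not_even_iff_odd.2 hN1odd) ((hc1.pow_of_ne_zero two_ne_zero).add this)
      have := Finset.dvd_lcm (f := fun q : ℕ => (q : ℤ) - legendreOrZero (-(P : ℤ)) q)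
        (hQ 2 Nat.prime_two h2k hP2)
      simpa [legendreOrZero, symbolLcm] using this
    · have := odd_re_of_odd_norm_sq (g ^ (2 ^ f * t)) (by rw [Zsqrtd.norm_pow]; exact hodd.pow)
      rwa [← pow_mul, show 2 ^ f * t * 2 = 2 ^ (f + 1) * t by ring] at this
  have hc1 := hone _ hc1odd fun q hq h => hU1 q hq (h.mul_left _)
  have hsq1 : (g ^ (2 ^ f * t)).re ^ 2 = 1 := by rw [← Int.natAbs_sq, hc1]; norm_num
  have hsq2 : (g ^ (2 ^ (f + 1) * t)).re ^ 2 = 1 := by rw [← Int.natAbs_sq, hc2]; norm_num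
  rw [hsq1] at hN1 hre1
  rw [hsq2, hg] at hre2
  rw [him1] at hre2 him2
  have hd0 : (g ^ (2 ^ f * t)).im ≠ 0 := by
    intro h
    rw [h, hk1] at him2
    simp at him2
    exact hk0 him2
  have hD1 : P * (g ^ (2 ^ f * t)).im.natAbs ^ 2 = 2 := by
    have hpos : 0 < P * (g ^ (2 ^ f * t)).im.natAbs ^ 2 := by
      have := Int.natAbs_ne_zero.2 hd0
      positivity
    omega
  rw [hD1] at hN1
  refine ⟨?_, 2 ^ f * t, by ring, by rw [← hN1]; norm_num⟩
  have h8 : ((P * ((g ^ (2 ^ f * t)).im * (2 * (g ^ (2 ^ f * t)).re)).natAbs ^ 2 : ℕ) : ℤ) = 8 := by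
    have hD1' : (P : ℤ) * (g ^ (2 ^ f * t)).im ^ 2 = 2 := by
      have := congrArg (Nat.cast : ℕ → ℤ) hD1
      push_cast at this
      rwa [sq_abs] at this
    push_cast
    rw [sq_abs]
    linear_combination 4 * (g ^ (2 ^ f * t)).re ^ 2 * hD1' + 8 * hsq1
  rw [h8] at hre2
  simp only [] at hre2
  omega

/-! ### Divisibility of the exponent -/

/-- The last `r`-th power step for an odd prime `r` whose power `r ^ (e + 1)` does not divide the
least common multiple: either `r = 3`, and the norm before the step is `3` or `3 ^ s + 4`, or
`r = 5`, and the step is `(±1 + √(-10)) ^ 5 = ±401 + 5√(-10)`. -/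
theorem norm_eq_of_odd_exponent {P Q : ℕ} {x k : ℤ} (g : ℤ√(-(P : ℤ)))
    (hQ : ∀ q : ℕ, q.Prime → (q : ℤ) ∣ k → ¬ q ∣ P → q ∈ Q.primeFactors)
    (hn : ∀ q : ℕ, q.Prime → q ∣ P ∨ (q : ℤ) ∣ k → ¬ (q : ℤ) ∣ g.norm)
    (hP0 : P ≠ 0) (hk0 : k ≠ 0) (hodd : Odd g.norm) (hx : AtMostOnePrime x) (hxodd : Odd x)
    (hN : AtMostOnePrime g.norm) {r e t : ℕ} (hr : r.Prime) (hr2 : Odd r)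
    (hg : g ^ (r ^ (e + 1) * t) = ⟨x, k⟩)
    (hL : ¬ ((r ^ (e + 1) : ℕ) : ℤ) ∣ symbolLcm P Q) :
    (r = 3 ∧ (g.norm ^ (r ^ e * t) = 3 ∨ ∃ s : ℕ, (3 : ℤ) ^ s + 4 = g.norm ^ (r ^ e * t))) ∨
      (r = 5 ∧ x.natAbs = 401 ∧ g.norm ^ (r ^ e * t) = 11) := by
  have hk1 : (g ^ (r ^ (e + 1) * t)).im = k := by rw [hg]
  obtain ⟨c, hc⟩ : ∃ c, c = (g ^ (r ^ e * t)).re := ⟨_, rfl⟩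
  obtain ⟨D, hD⟩ : ∃ D, D = P * (g ^ (r ^ e * t)).im.natAbs ^ 2 := ⟨_, rfl⟩
  obtain ⟨hnorm, hcop, hre, him, hU⟩ := no_primitive_prime g hQ hn hr hk1.dvd hL hc hD
  rw [hg] at hre him
  simp only [] at hre him
  have hU0 : ((⟨c, 1⟩ : ℤ√(-(D : ℤ))) ^ r).im ≠ 0 := fun h => hk0 (by rw [him, h, mul_zero])
  have hD0 : 0 < D := by
    have hd0 : (g ^ (r ^ e * t)).im ≠ 0 := fun h => hk0 (by rw [him, h, zero_mul])
    have := Int.natAbs_ne_zero.2 hd0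
    rw [hD]
    positivity
  have hcodd : Odd c := by
    obtain ⟨s, hs⟩ := dvd_re_pow_of_odd (D := D) (c := c) hr2
    rw [hre, hs] at hxodd
    exact (Int.odd_mul.1 hxodd).1
  have hDeven : Even D := by
    have h1 : Odd (c ^ 2 + D) := by rw [hnorm]; exact hodd.pow
    rw [Int.odd_add] at h1
    rw [← Int.even_coe_nat]
    exact h1.1 hcodd.pow
  rw [hre] at hx
  rw [← hnorm]
  by_cases hr3 : r = 3
  · subst hr3
    left
    refine ⟨rfl, ?_⟩
    rcases norm_eq_of_exponent_three hD0 hcop hx hcodd hU0 hU with h | ⟨s, hs⟩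
    · exact Or.inl h
    · exact Or.inr ⟨s, hs.symm⟩
  · right
    have hr5 : 5 ≤ r := by
      have h1 := hr.two_le
      have h2 : r ≠ 2 := by rintro rfl; revert hr2; decide
      have h4 : r ≠ 4 := by rintro rfl; revert hr2; decide
      omega
    obtain ⟨rfl, rfl, hc1⟩ := eq_ten_of_prime_exponent hr hr5 hDeven hD0 hcop hx
      (by rw [hnorm]; exact hN.pow _) hU0 hU
    have hc2 : c ^ 2 = 1 := by rw [← Int.natAbs_sq, hc1]; norm_num
    refine ⟨rfl, ?_, by rw [hc2]; norm_num⟩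
    rw [hre]
    have h5 : ((⟨c, 1⟩ : ℤ√(-((10 : ℕ) : ℤ))) ^ 5).re = c * (c ^ 4 - 100 * c ^ 2 + 500) := by
      rw [show 5 = 2 + 2 + 1 by norm_num, pow_succ, pow_add, sq]
      simp
      ring
    rw [h5, Int.natAbs_mul, hc1, show c ^ 4 = (c ^ 2) ^ 2 by ring, hc2]
    norm_num

theorem idealExponent_spec (P : ℕ) : 0 < idealExponent P ∧
    ∀ I : Ideal (NumberField.RingOfIntegers (imagQuadField P)),
      (I ^ idealExponent P).IsPrincipal := by
  refine Nat.sInf_mem (s := {h : ℕ | 0 < h ∧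
    ∀ I : Ideal (NumberField.RingOfIntegers (imagQuadField P)), (I ^ h).IsPrincipal}) ?_
  refine ⟨Fintype.card (ClassGroup (NumberField.RingOfIntegers (imagQuadField P))),
    Fintype.card_pos, fun I => ?_⟩
  by_cases hI : I = 0
  · rw [hI, zero_pow Fintype.card_ne_zero]
    exact bot_isPrincipal
  · have hIm : I ∈ nonZeroDivisors (Ideal (NumberField.RingOfIntegers (imagQuadField P))) :=
      mem_nonZeroDivisors_of_ne_zero hI
    have h1 : ClassGroup.mk0 ⟨I, hIm⟩ ^
        Fintype.card (ClassGroup (NumberField.RingOfIntegers (imagQuadField P))) = 1 :=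
      pow_card_eq_one
    rw [← map_pow, ClassGroup.mk0_eq_one_iff] at h1
    exact h1

theorem prime_dvd_of_isGreatest_squarefree {C M q : ℕ}
    (hM : IsGreatest {d : ℕ | Squarefree d ∧ d ∣ C} M) (hq : q.Prime) (hqC : q ∣ C) : q ∣ M := by
  by_contra hqM
  have hcop : Nat.Coprime q M := (Nat.Prime.coprime_iff_not_dvd hq).2 hqM
  have h1 := hM.2 ⟨(Nat.squarefree_mul hcop).2 ⟨hq.squarefree, hM.1.1⟩,
    hcop.mul_dvd_of_dvd_of_dvd hqC hM.1.2⟩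
  have h2 := Nat.pos_of_ne_zero hM.1.1.ne_zero
  have h3 := hq.two_le
  nlinarith

theorem theorem4 (C P Q : ℕ) (hC : 0 < C) (hCeven : Even C)
    (hPQ : IsGreatest {d : ℕ | Squarefree d ∧ d ∣ C} (P * Q))
    (hP : ∃ k : ℕ, C = P * k ^ 2)
    (x y : ℤ) (n : ℕ) (hn : 0 < n)
    (hx : AtMostOnePrime x) (hy : AtMostOnePrime y) (hxy : IsCoprime x y)
    (heq : x ^ 2 + (C : ℤ) = y ^ n)
    (hexc₁ : ¬ (|x| = 7 ∧ |y| = 3 ∧ n = 4))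
    (hexc₂ : ¬ (|x| = 401 ∧ |y| = 11 ∧ n = 5)) :
    n = 3 ∨ (n : ℤ) ∣ exponentBound P Q := by
  obtain ⟨k, hCk⟩ := hP
  have hPsq : Squarefree P := hPQ.1.1.of_mul_left
  have hQ0 : Q ≠ 0 := (hPQ.1.1.of_mul_right).ne_zero
  have hP0 : P ≠ 0 := hPsq.ne_zero
  have hk0 : k ≠ 0 := by rintro rfl; simp at hCk; omega
  have hcopn : IsCoprime (x ^ 2) (y ^ n) := hxy.pow
  have hxodd : Odd x := by
    by_contra h
    rw [Int.not_odd_iff_even] at h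
    have h1 : Even (x ^ 2) := h.pow_of_ne_zero two_ne_zero
    have h2 : Even (y ^ n) := by rw [← heq]; exact h1.add (by exact_mod_cast hCeven)
    have := hcopn.isUnit_of_dvd' h1.two_dvd h2.two_dvd
    exact Int.prime_two.not_isUnit this
  have hyodd : Odd y := by
    have h1 : Odd (y ^ n) := by rw [← heq]; exact hxodd.pow.add_even (by exact_mod_cast hCeven)
    exact (Int.odd_pow' hn.ne').1 h1
  have hyn : |y| ^ n = y ^ n := by
    rw [← abs_pow, abs_of_pos]
    rw [← heq]; positivity
  have heqk : x ^ 2 + P * (k : ℤ) ^ 2 = y ^ n := by rw [← heq, hCk]; push_cast; rfl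
  obtain ⟨hh0, hh⟩ := idealExponent_spec P
  obtain ⟨g, l, m, hnlm, hl, hgm⟩ := exists_pow_eq_in_zsqrtd hPsq hn hh heqk
    (IsCoprime.mul_left (Int.isCoprime_two_left.2 hyodd) hxy) (fun _ => hxodd)
  have hm0 : m ≠ 0 := by rintro rfl; simp at hnlm; omega
  -- absorb the sign
  obtain ⟨x', k', hgx, hxx, hkk⟩ : ∃ x' k' : ℤ, g ^ m = ⟨x', k'⟩ ∧ x'.natAbs = x.natAbs ∧
      k'.natAbs = k := by
    rcases hgm with h | h
    · exact ⟨x, k, h, rfl, by simp⟩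
    · exact ⟨-x, -k, h, by simp, by simp⟩
  have hx' : AtMostOnePrime x' := hx.of_dvd (Int.natAbs_dvd_natAbs.1 (by rw [hxx]))
  have hxodd' : Odd x' := by rw [← Int.natAbs_odd, hxx, Int.natAbs_odd]; exact hxodd
  have hk0' : k' ≠ 0 := by rintro rfl; exact hk0 (by simpa using hkk.symm)
  have hgnorm : g.norm = |y| ^ l := by
    have h1 := Zsqrtd.norm_pow g m
    rw [hgx, norm_mk_neg, ← Int.natAbs_sq x', ← Int.natAbs_sq k', hxx, hkk, Int.natAbs_sq,
      heqk, ← hyn, hnlm, pow_mul] at h1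
    exact ((pow_left_inj₀ (by positivity) (Zsqrtd.norm_nonneg (by simp) g) hm0).1 h1).symm
  have hyabs : AtMostOnePrime |y| := hy.of_dvd (abs_dvd_self y)
  have hnormC : ∀ q : ℕ, q.Prime → q ∣ C → ¬ (q : ℤ) ∣ g.norm := by
    intro q hq hqC hqn
    have hqz := Nat.prime_iff_prime_int.1 hq
    rw [hgnorm] at hqn
    have h1 : (q : ℤ) ∣ y ^ n :=
      dvd_pow ((dvd_abs _ _).1 (hqz.dvd_of_dvd_pow hqn)) hn.ne'
    have h2 : (q : ℤ) ∣ x ^ 2 := by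
      rw [← heq] at h1
      exact (dvd_add_left (Int.natCast_dvd_natCast.2 hqC)).1 h1
    exact hqz.not_isUnit (hcopn.isUnit_of_dvd' h2 h1)
  have hkC : ∀ q : ℕ, (q : ℤ) ∣ k' → q ∣ C := by
    intro q h
    rw [Int.natCast_dvd, hkk] at h
    rw [hCk]
    exact (dvd_pow h two_ne_zero).mul_left _
  have hnq : ∀ q : ℕ, q.Prime → q ∣ P ∨ (q : ℤ) ∣ k' → ¬ (q : ℤ) ∣ g.norm := by
    rintro q hq (h | h)
    · exact hnormC q hq (by rw [hCk]; exact h.mul_right _)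
    · exact hnormC q hq (hkC q h)
  have hQq : ∀ q : ℕ, q.Prime → (q : ℤ) ∣ k' → ¬ q ∣ P → q ∈ Q.primeFactors := by
    intro q hq h hqP
    have h1 := prime_dvd_of_isGreatest_squarefree hPQ hq (hkC q h)
    exact Nat.mem_primeFactors.2 ⟨hq, (hq.dvd_mul.1 h1).resolve_left hqP, hQ0⟩
  have hgodd : Odd g.norm := by rw [hgnorm]; exact (odd_abs.2 hyodd).pow
  have hgN : AtMostOnePrime g.norm := by rw [hgnorm]; exact hyabs.pow l
  by_cases hmL : (m : ℤ) ∣ 2 * symbolLcm P Q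
  · right
    rw [exponentBound, hnlm, show (2 : ℤ) * 3 ^ (if 3 < P ∧ P % 8 = 3 then 1 else 0) *
      (idealExponent P : ℤ) * symbolLcm P Q = (3 ^ (if 3 < P ∧ P % 8 = 3 then 1 else 0) *
      (idealExponent P : ℤ)) * (2 * symbolLcm P Q) by ring]
    push_cast
    exact mul_dvd_mul (by exact_mod_cast hl) hmL
  left
  rw [Int.natCast_dvd, Nat.dvd_iff_prime_pow_dvd_dvd] at hmL
  push Not at hmL
  obtain ⟨r, e, hr, ⟨t, hmt⟩, hL⟩ := hmL
  rw [← Int.natCast_dvd] at hL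
  obtain ⟨e, rfl⟩ : ∃ f, e = f + 1 := by
    rcases e with _ | f
    · simp at hL
    · exact ⟨f, rfl⟩
  rw [hmt] at hgx
  have one_of_prime : ∀ p i : ℕ, p.Prime → |y| ^ i = p → i = 1 ∧ |y| = p := by
    intro p i hp h
    have h1 : y.natAbs ^ i = p := by zify; exact h
    have h2 : i = 1 := Nat.Prime.eq_one_of_pow (x := y.natAbs) (by rw [h1]; exact hp)
    exact ⟨h2, by rw [← h, h2, pow_one]⟩
  rcases hr.eq_two_or_odd' with rfl | hrodd
  -- the norm `3` is a power of `|y|`, which gives the exception `7² + 32 = 3 ^ 4`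
  · exfalso
    obtain ⟨h7, j, hj, h3⟩ :=
      natAbs_eq_seven_of_exponent_two g hQq hnq hP0 hk0' hgodd hgx hL
    rw [hgnorm, ← pow_mul] at h3
    obtain ⟨hi, hy3⟩ := one_of_prime 3 _ Nat.prime_three h3
    refine hexc₁ ⟨?_, hy3, ?_⟩
    · rw [Int.abs_eq_natAbs, ← hxx, h7]; rfl
    · rw [hnlm, hmt, hj, mul_left_comm, hi, mul_one]
  · have hL' : ¬ ((r ^ (e + 1) : ℕ) : ℤ) ∣ symbolLcm P Q := fun h => hL (h.mul_left 2)
    have hn' : n = r * (l * (r ^ e * t)) := by rw [hnlm, hmt]; ring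
    rcases norm_eq_of_odd_exponent g hQq hnq hP0 hk0' hgodd hx' hxodd' hgN hr hrodd hgx hL' with
      ⟨rfl, h3 | ⟨s, hs⟩⟩ | ⟨rfl, h401, h11⟩
    · rw [hgnorm, ← pow_mul] at h3
      rw [hn', (one_of_prime 3 _ Nat.prime_three h3).1]
    · rw [hgnorm, ← pow_mul] at hs
      have hi : l * (3 ^ e * t) = 1 := by
        by_contra hi
        exact three_pow_add_four_ne_pow hyabs (abs_pos.2 hy.1) hi hs
      rw [hn', hi]
    -- the exception `401² + 250 = 11 ^ 5`
    · exfalso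
      rw [hgnorm, ← pow_mul] at h11
      obtain ⟨hi, hy11⟩ := one_of_prime 11 _ (by norm_num) h11
      refine hexc₂ ⟨?_, hy11, ?_⟩
      · rw [Int.abs_eq_natAbs, ← hxx, h401]; rfl
      · rw [hn', hi]
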